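/- Let $T>0$ and $n,m\ge 0$ be integers. Let $A,C\in L^\infty(0,T;\mathbb R^{n\times n})$, $B,D\in L^\infty(0,T;\mathbb R^{n\times m})$, and let $G\in C([0,T];\mathbb S^n)$, $Q\in C([0,T]^2;\mathbb S^n)$, $R\in C([0,T]^2;\mathbb S^m)$, where $\mathbb S^k$ denotes the symmetric real $k\times k$ matrices, ordered by $M\le N$ iff $N-M$ is positive semi-definite, and $\mathbb S^k_+=\{M\in\mathbb S^k: M\ge 0\}$. Suppose that: (i) there is $\delta>0$ such that $Q(t,s)\ge 0$, $R(t,s)\ge\delta I$ and $G(t)\ge 0$ for all $0\le t\le s\le T$; (ii) there are positive definite matrices $\widehat Q,\widehat G\in\mathbb S^n$, $\widehat R\in\mathbb S^m$ such that for all $0\le t\le r\le s\le T$ $$Q(t,s)\le Q(r,s)\le\widehat Q,\qquad R(t,s)\le R(r,s)\le\widehat R,\qquad G(t)\le G(r)\le\widehat G .$$ Then the equilibrium Riccati equation $$\begin{cases}\partial_sP(t,s)+P(t,s)A_\Theta(s)+A_\Theta(s)^\top P(t,s)+C_\Theta(s)^\top P(t,s)C_\Theta(s)+Q(t,s)+\Theta(s)^\top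 R(t,s)\Theta(s)=0,& 0\le t\le s\le T,\\ P(t,T)=G(t),& 0\le t\le T,\end{cases}$$ where $$\Theta(s)=-\big[R(s,s)+D(s)^\top P(s,s)D(s)\big]^{-1}\big[B(s)^\top P(s,s)+D(s)^\top P(s,s)C(s)\big],$$ $$A_\Theta(s)=A(s)+B(s)\Theta(s),\qquad C_\Theta(s)=C(s)+D(s)\Theta(s),$$ has a unique solution $P\in C(\Delta^*[0,T];\mathbb S^n_+)$, where $\Delta^*[0,T]=\{(t,s):0\le t\le s\le T\}$. Moreover, the function $\Theta$ associated with this solution belongs to $L^\infty(0,T;\mathbb R^{m\times n})$. Here, since the coefficients are only measurable in time, the equation is understood in the Carathéodory sense: for every $t\in[0,T]$ and all $s\in[t,T]$, $$P(t,s)=G(t)+\int_s^T\Big(P(t,r)A_\Theta(r)+A_\Theta(r)^\top P(t,r)+C_\Theta(r)^\top P(t,r)C_\Theta(r)+Q(t,r)+\Theta(r)^\top R(t,r)\Theta(r)\Big)dr ,$$ with an integrable integrand (equivalently, $P(t,\cdot)$ is absolutely continuous on $[t,T]$ with $P(t,T)=G(t)$ and satisfies the differential equation for almost every $s\in[t,T]$).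 -/

import Mathlib

open MeasureTheory Set
open scoped Matrix

/-- The coefficients `A, B, C, D` and the weighting matrices `Q, R, G` of a (time-inconsistent)
stochastic linear-quadratic problem with `n`-dimensional state and `m`-dimensional control.
These are bare functions of time; only their values for times in `[0, T]` matter. -/
structure LQCoeff (n m : ℕ) where
  A : ℝ → Matrix (Fin n) (Fin n) ℝ
  B : ℝ → Matrix (Fin n) (Fin m) ℝ
  C : ℝ → Matrix (Fin n) (Fin n) ℝ
  D : ℝ → Matrix (Fin n) (Fin m) ℝ
  Q : ℝ → ℝ → Matrix (Fin n) (Fin n) ℝ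
  R : ℝ → ℝ → Matrix (Fin m) (Fin m) ℝ
  G : ℝ → Matrix (Fin n) (Fin n) ℝ

/-- `M ∈ L^∞(0, T; ℝ^{p × q})`: Lebesgue measurable and essentially bounded on `[0, T]`
(for matrix-valued functions this is the same as for every entry). -/
def MemLInfty {p q : ℕ} (T : ℝ) (M : ℝ → Matrix (Fin p) (Fin q) ℝ) : Prop :=
  ∀ i j, MemLp (fun s => M s i j) ⊤ (volume.restrict (Icc 0 T))

/-- The triangle `Δ*[0, T] = {(t, s) ∈ [0, T]² : t ≤ s}`. -/
def triangle (T : ℝ) : Set (ℝ × ℝ) := {p | 0 ≤ p.1 ∧ p.1 ≤ p.2 ∧ p.2 ≤ T}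

namespace LQCoeff

variable {n m : ℕ}

/-- `A, B, C, D` are essentially bounded on `[0, T]`; the weights are symmetric-matrix-valued and
continuous on `[0, T]` (for `G`) and on `[0, T]²` (for `Q` and `R`). -/
structure IsRegular (c : LQCoeff n m) (T : ℝ) : Prop where
  A_mem : MemLInfty T c.A
  B_mem : MemLInfty T c.B
  C_mem : MemLInfty T c.C
  D_mem : MemLInfty T c.D
  G_cont : ContinuousOn c.G (Icc 0 T)
  Q_cont : ContinuousOn (fun p : ℝ × ℝ => c.Q p.1 p.2) (Icc 0 T ×ˢ Icc 0 T)
  R_cont : ContinuousOn (fun p : ℝ × ℝ => c.R p.1 p.2) (Icc 0 T ×ˢ Icc 0 T)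
  G_symm : ∀ t ∈ Icc 0 T, (c.G t).IsSymm
  Q_symm : ∀ t ∈ Icc 0 T, ∀ s ∈ Icc 0 T, (c.Q t s).IsSymm
  R_symm : ∀ t ∈ Icc 0 T, ∀ s ∈ Icc 0 T, (c.R t s).IsSymm

/-- For some `δ > 0`: `Q(t,s) ≥ 0`, `R(t,s) ≥ δ I` and `G(t) ≥ 0` for all `0 ≤ t ≤ s ≤ T`. -/
def IsPositive (c : LQCoeff n m) (T : ℝ) : Prop :=
  ∃ δ : ℝ, 0 < δ ∧ ∀ t s : ℝ, 0 ≤ t → t ≤ s → s ≤ T →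
    (c.Q t s).PosSemidef ∧
    (c.R t s - δ • (1 : Matrix (Fin m) (Fin m) ℝ)).PosSemidef ∧
    (c.G t).PosSemidef

/-- Monotonicity in the initial time, in the Loewner order, with positive definite upper bounds:
`Q(t,s) ≤ Q(r,s) ≤ Qhat`, `R(t,s) ≤ R(r,s) ≤ Rhat` and `G(t) ≤ G(r) ≤ Ghat`
for all `0 ≤ t ≤ r ≤ s ≤ T`. -/
def IsMonotone (c : LQCoeff n m) (T : ℝ) : Prop :=
  ∃ (Qhat : Matrix (Fin n) (Fin n) ℝ) (Rhat : Matrix (Fin m) (Fin m) ℝ)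
    (Ghat : Matrix (Fin n) (Fin n) ℝ),
    Qhat.PosDef ∧ Rhat.PosDef ∧ Ghat.PosDef ∧
    ∀ t r s : ℝ, 0 ≤ t → t ≤ r → r ≤ s → s ≤ T →
      ((c.Q r s - c.Q t s).PosSemidef ∧ (Qhat - c.Q r s).PosSemidef) ∧
      ((c.R r s - c.R t s).PosSemidef ∧ (Rhat - c.R r s).PosSemidef) ∧
      ((c.G r - c.G t).PosSemidef ∧ (Ghat - c.G r).PosSemidef)

/-- `Θ(s) = -[R(s,s) + D(s)ᵀ P(s,s) D(s)]⁻¹ [B(s)ᵀ P(s,s) + D(s)ᵀ P(s,s) C(s)]`.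
When `R(s,s) > 0` and `P(s,s) ≥ 0` the bracket is positive definite, hence invertible. -/
noncomputable def Theta (c : LQCoeff n m) (P : ℝ → ℝ → Matrix (Fin n) (Fin n) ℝ) (s : ℝ) :
    Matrix (Fin m) (Fin n) ℝ :=
  -((c.R s s + (c.D s)ᵀ * P s s * c.D s)⁻¹ *
    ((c.B s)ᵀ * P s s + (c.D s)ᵀ * P s s * c.C s))

/-- `A_Θ(s) = A(s) + B(s) Θ(s)`. -/
noncomputable def ATheta (c : LQCoeff n m) (P : ℝ → ℝ → Matrix (Fin n) (Fin n) ℝ) (s : ℝ) :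
    Matrix (Fin n) (Fin n) ℝ :=
  c.A s + c.B s * c.Theta P s

/-- `C_Θ(s) = C(s) + D(s) Θ(s)`. -/
noncomputable def CTheta (c : LQCoeff n m) (P : ℝ → ℝ → Matrix (Fin n) (Fin n) ℝ) (s : ℝ) :
    Matrix (Fin n) (Fin n) ℝ :=
  c.C s + c.D s * c.Theta P s

/-- The expression
`P(t,s) A_Θ(s) + A_Θ(s)ᵀ P(t,s) + C_Θ(s)ᵀ P(t,s) C_Θ(s) + Q(t,s) + Θ(s)ᵀ R(t,s) Θ(s)`,
which is `-∂ₛ P(t,s)` in the equilibrium Riccati equation. -/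
noncomputable def ereField (c : LQCoeff n m) (P : ℝ → ℝ → Matrix (Fin n) (Fin n) ℝ) (t s : ℝ) :
    Matrix (Fin n) (Fin n) ℝ :=
  P t s * c.ATheta P s + (c.ATheta P s)ᵀ * P t s
    + (c.CTheta P s)ᵀ * P t s * c.CTheta P s
    + c.Q t s + (c.Theta P s)ᵀ * c.R t s * c.Theta P s

/-- `P` is a solution in `C(Δ*[0,T]; S^n_+)` of the equilibrium Riccati equation
`∂ₛ P(t,s) + ereField t s = 0` for `0 ≤ t ≤ s ≤ T`, with `P(t,T) = G(t)`.
Since the coefficients are only measurable in time, the equation is understood in the usual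
(Carathéodory) sense: for every `t`, `P(t,s) = G(t) + ∫_s^T ereField t r dr` for `t ≤ s ≤ T`,
entrywise and with an integrable integrand; equivalently, `P(t,·)` is absolutely continuous,
has terminal value `G(t)`, and satisfies the differential equation for almost every `s`.
Only the values of `P` on `Δ*[0,T]` are involved. -/
structure IsERESolution (c : LQCoeff n m) (T : ℝ)
    (P : ℝ → ℝ → Matrix (Fin n) (Fin n) ℝ) : Prop where
  cont : ContinuousOn (fun p : ℝ × ℝ => P p.1 p.2) (triangle T)
  posSemidef : ∀ t s : ℝ, (t, s) ∈ triangle T → (P t s).PosSemidef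
  integrable : ∀ t ∈ Icc 0 T, ∀ i j,
    IntervalIntegrable (fun r => c.ereField P t r i j) volume t T
  eq : ∀ t s : ℝ, (t, s) ∈ triangle T → ∀ i j,
    P t s i j = c.G t i j + ∫ r in s..T, c.ereField P t r i j

end LQCoeff

/-!
The existence proof solves a truncated equation and then removes the truncation by an a priori
estimate. Coefficients are first modified on a null set, and the weights extended to all real times
by projection onto `[0, T]`, so that all bounds, signs and monotonicities hold everywhere
(`LQCoeff.exists_isGloballyRegular`).

Truncation: in the feedback, the diagonal value `P(s,s)` is replaced by `psdCut M (P(s,s))`, which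
is positive semidefinite, bounded by `M`, a Lipschitz function of `P(s,s)`, and a scalar multiple
`λ P(s,s)` with `λ ∈ (0, 1]` once `P(s,s) ≥ 0`. The feedback is then bounded, and a weighted
contraction argument (`exists_volterra_solution`) gives a solution on the whole triangle
(`LQCoeff.IsGloballyRegular.exists_truncated_solution`).

For a given feedback the equation is a family of linear Lyapunov equations, whose solutions are
positive semidefinite when the data are (`posSemidef_of_lyapunov_eq`). Applied to `P(t, ·)` and,
with the monotone weights, to `P(t', ·) - P(t, ·)`, this gives `P ≥ 0` and the monotonicity of
`P(t,s)` in `t`.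

A priori estimate: by monotonicity, going from `(s, s)` to `(s - h, s - h)` costs at most the
vertical increment, `tr P(s-h,s-h) ≤ tr P(s,s) + ∫_{s-h}^s tr (field)`. To first order in `h` the
field may be evaluated on the diagonal, and there the feedback is the optimal one for the control
weight `λ⁻¹ R ≥ R`, so the trace of the field is at most its value for zero control
(`LQCoeff.trace_riccatiField_feedback_le`). That value grows linearly in `tr P(s,s)`, with constants
that do not involve `M`, and Gronwall's inequality bounds the diagonal independently of `M`
(`LQCoeff.IsLinearSolution.trace_diag_le`). For `M` above this bound the truncation is inactive.

Uniqueness follows from a Gronwall inequality on the triangle (`le_of_le_integral_triangle`), since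
any two solutions are bounded and hence solve a common truncated equation.
-/

section EquilibriumRiccati

open Filter Topology

/-! ### The sup norm on matrices -/

/-- The sup norm of the entries, with the topology replaced by the (equal) product topology that is
already an instance on matrices, so that the two agree at instance transparency. -/
noncomputable abbrev matrixNormedAddCommGroup (p q : ℕ) :
    NormedAddCommGroup (Matrix (Fin p) (Fin q) ℝ) :=
  letI N : NormedAddCommGroup (Matrix (Fin p) (Fin q) ℝ) := Matrix.normedAddCommGroup
  { N with
    toMetricSpace := N.toMetricSpace.replaceTopology (U := inferInstance) rfl
    dist_eq := N.dist_eq }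

attribute [local instance] matrixNormedAddCommGroup

/-- The normed space structure that goes with the sup norm of the entries. -/
noncomputable abbrev matrixNormedSpace (p q : ℕ) : NormedSpace ℝ (Matrix (Fin p) (Fin q) ℝ) :=
  letI _N : NormedAddCommGroup (Matrix (Fin p) (Fin q) ℝ) := Matrix.normedAddCommGroup
  letI S : NormedSpace ℝ (Matrix (Fin p) (Fin q) ℝ) := Matrix.normedSpace
  { S with norm_smul_le := S.norm_smul_le }

attribute [local instance] matrixNormedSpace

theorem completeSpace_matrix (p q : ℕ) : CompleteSpace (Matrix (Fin p) (Fin q) ℝ) :=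
  FiniteDimensional.complete ℝ _

attribute [local instance] completeSpace_matrix

/-! ### Uniformly bounded and Lipschitz families of matrices -/

theorem norm_matrix_mul_le {p q k : ℕ} (A : Matrix (Fin p) (Fin q) ℝ)
    (B : Matrix (Fin q) (Fin k) ℝ) : ‖A * B‖ ≤ q * ‖A‖ * ‖B‖ := by
  refine (Matrix.norm_le_iff (by positivity)).2 fun i j => ?_
  rw [Matrix.mul_apply]
  refine (norm_sum_le _ _).trans ?_
  refine (Finset.sum_le_card_nsmul _ _ (‖A‖ * ‖B‖) fun l _ => ?_).trans ?_
  · rw [norm_mul]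
    gcongr <;> exact Matrix.norm_entry_le_entrywise_sup_norm _
  · simp [mul_assoc]

/-- A family `φ i : X → ℝ^{p × q}` of matrix-valued functions that is bounded and Lipschitz, with
constants independent of the index `i`. -/
def UniformlyBddLip {ι X : Type*} [PseudoMetricSpace X] {p q : ℕ}
    (φ : ι → X → Matrix (Fin p) (Fin q) ℝ) : Prop :=
  ∃ K : ℝ, 0 ≤ K ∧ (∀ i x, ‖φ i x‖ ≤ K) ∧ ∀ i x y, ‖φ i x - φ i y‖ ≤ K * dist x y

namespace UniformlyBddLip

variable {ι X : Type*} [PseudoMetricSpace X] {p q k : ℕ}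

theorem const {φ : ι → Matrix (Fin p) (Fin q) ℝ} {K : ℝ} (h : ∀ i, ‖φ i‖ ≤ K) :
    UniformlyBddLip (fun i (_ : X) => φ i) := by
  refine ⟨|K|, abs_nonneg K, fun i _ => (h i).trans (le_abs_self K), fun i x y => ?_⟩
  rw [sub_self, norm_zero]
  positivity

theorem add {φ ψ : ι → X → Matrix (Fin p) (Fin q) ℝ} (hφ : UniformlyBddLip φ)
    (hψ : UniformlyBddLip ψ) : UniformlyBddLip (fun i x => φ i x + ψ i x) := by
  obtain ⟨K, hK, hb, hl⟩ := hφ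
  obtain ⟨K', hK', hb', hl'⟩ := hψ
  refine ⟨K + K', by positivity, fun i x => norm_add_le_of_le (hb i x) (hb' i x),
    fun i x y => ?_⟩
  rw [add_sub_add_comm, add_mul]
  exact norm_add_le_of_le (hl i x y) (hl' i x y)

theorem neg {φ : ι → X → Matrix (Fin p) (Fin q) ℝ} (hφ : UniformlyBddLip φ) :
    UniformlyBddLip (fun i x => -φ i x) := by
  obtain ⟨K, hK, hb, hl⟩ := hφ
  refine ⟨K, hK, fun i x => by simpa using hb i x, fun i x y => ?_⟩
  rw [neg_sub_neg, norm_sub_rev]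
  exact hl i x y

theorem transpose {φ : ι → X → Matrix (Fin p) (Fin q) ℝ} (hφ : UniformlyBddLip φ) :
    UniformlyBddLip (fun i x => (φ i x)ᵀ) := by
  obtain ⟨K, hK, hb, hl⟩ := hφ
  refine ⟨K, hK, fun i x => by simpa [Matrix.norm_transpose] using hb i x, fun i x y => ?_⟩
  rw [← Matrix.transpose_sub, Matrix.norm_transpose]
  exact hl i x y

theorem mul {φ : ι → X → Matrix (Fin p) (Fin q) ℝ} {ψ : ι → X → Matrix (Fin q) (Fin k) ℝ}
    (hφ : UniformlyBddLip φ) (hψ : UniformlyBddLip ψ) :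
    UniformlyBddLip (fun i x => φ i x * ψ i x) := by
  obtain ⟨K, hK, hb, hl⟩ := hφ
  obtain ⟨K', hK', hb', hl'⟩ := hψ
  refine ⟨2 * q * K * K', by positivity, fun i x => ?_, fun i x y => ?_⟩
  · calc ‖φ i x * ψ i x‖ ≤ q * ‖φ i x‖ * ‖ψ i x‖ := norm_matrix_mul_le _ _
      _ ≤ q * K * K' := by
          gcongr
          · exact hb i x
          · exact hb' i x
      _ ≤ 2 * q * K * K' := by nlinarith [show 0 ≤ q * K * K' by positivity]
  · calc ‖φ i x * ψ i x - φ i y * ψ i y‖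
        = ‖(φ i x - φ i y) * ψ i x + φ i y * (ψ i x - ψ i y)‖ := by
          rw [Matrix.sub_mul, Matrix.mul_sub]; abel_nf
      _ ≤ q * ‖φ i x - φ i y‖ * ‖ψ i x‖ + q * ‖φ i y‖ * ‖ψ i x - ψ i y‖ :=
          norm_add_le_of_le (norm_matrix_mul_le _ _) (norm_matrix_mul_le _ _)
      _ ≤ q * (K * dist x y) * K' + q * K * (K' * dist x y) := by
          gcongr
          · exact hl i x y
          · exact hb' i x
          · exact hb i y
          · exact hl' i x y
      _ = 2 * q * K * K' * dist x y := by ring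

end UniformlyBddLip

theorem Matrix.PosSemidef.dotProduct_nonneg_real {p : ℕ} {M : Matrix (Fin p) (Fin p) ℝ}
    (h : M.PosSemidef) (x : Fin p → ℝ) : 0 ≤ x ⬝ᵥ (M *ᵥ x) := by
  simpa using h.dotProduct_mulVec_nonneg x

theorem Matrix.posSemidef_of_real {p : ℕ} {M : Matrix (Fin p) (Fin p) ℝ} (hs : M.IsSymm)
    (h : ∀ x : Fin p → ℝ, 0 ≤ x ⬝ᵥ (M *ᵥ x)) : M.PosSemidef := by
  refine Matrix.PosSemidef.of_dotProduct_mulVec_nonneg ?_ fun x => by simpa using h x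
  rwa [Matrix.IsHermitian, Matrix.conjTranspose_eq_transpose_of_trivial]

theorem Matrix.PosSemidef.isSymm_real {p : ℕ} {M : Matrix (Fin p) (Fin p) ℝ}
    (h : M.PosSemidef) : M.IsSymm := by
  have := h.isHermitian
  rwa [Matrix.IsHermitian, Matrix.conjTranspose_eq_transpose_of_trivial] at this

theorem Matrix.PosSemidef.transpose_mul_mul {p q : ℕ} {M : Matrix (Fin p) (Fin p) ℝ}
    (h : M.PosSemidef) (N : Matrix (Fin p) (Fin q) ℝ) : (Nᵀ * M * N).PosSemidef := by
  have := h.conjTranspose_mul_mul_same N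
  rwa [Matrix.conjTranspose_eq_transpose_of_trivial] at this

theorem isUnit_of_coercive {p : ℕ} {δ : ℝ} (hδ : 0 < δ) {X : Matrix (Fin p) (Fin p) ℝ}
    (hX : (X - δ • (1 : Matrix (Fin p) (Fin p) ℝ)).PosSemidef) : IsUnit X := by
  have h1 : (δ • (1 : Matrix (Fin p) (Fin p) ℝ)).PosDef := Matrix.PosDef.one.smul hδ
  have := h1.add_posSemidef hX
  rw [add_sub_cancel] at this
  exact this.isUnit

theorem norm_inv_le_of_coercive {p : ℕ} {δ : ℝ} (hδ : 0 < δ) {X : Matrix (Fin p) (Fin p) ℝ}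
    (hX : (X - δ • (1 : Matrix (Fin p) (Fin p) ℝ)).PosSemidef) : ‖X⁻¹‖ ≤ δ⁻¹ := by
  have hu := isUnit_of_coercive hδ hX
  have hXi : X * X⁻¹ = 1 := Matrix.mul_nonsing_inv _ ((Matrix.isUnit_iff_isUnit_det _).1 hu)
  -- testing with the `j`-th column `z` of `X⁻¹` gives `δ |z|² ≤ z_j`
  have key : ∀ i j, δ * (X⁻¹ i j) ^ 2 ≤ X⁻¹ j j := by
    intro i j
    have h := hX.dotProduct_nonneg_real (fun k => X⁻¹ k j)
    have h2 : X *ᵥ (fun k => X⁻¹ k j) = fun k => (1 : Matrix (Fin p) (Fin p) ℝ) k j := by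
      ext k
      rw [← hXi]; rfl
    rw [Matrix.sub_mulVec, h2, Matrix.smul_mulVec, Matrix.one_mulVec, dotProduct_sub,
      dotProduct_smul] at h
    have h3 : (fun k => X⁻¹ k j) ⬝ᵥ (fun k => (1 : Matrix (Fin p) (Fin p) ℝ) k j) = X⁻¹ j j := by
      simp [dotProduct, Matrix.one_apply]
    have h4 : (X⁻¹ i j) ^ 2 ≤ (fun k => X⁻¹ k j) ⬝ᵥ (fun k => X⁻¹ k j) := by
      rw [dotProduct, sq]
      exact Finset.single_le_sum (f := fun k => X⁻¹ k j * X⁻¹ k j)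
        (fun k _ => mul_self_nonneg _) (Finset.mem_univ i)
    rw [h3, smul_eq_mul] at h
    nlinarith
  have hδi : 0 < δ⁻¹ := inv_pos.2 hδ
  have hδ1 : δ * δ⁻¹ = 1 := mul_inv_cancel₀ hδ.ne'
  have hd : ∀ j, X⁻¹ j j ≤ δ⁻¹ := by
    intro j
    by_contra! hc
    nlinarith [key j j, mul_lt_mul_of_pos_left hc hδ]
  refine (Matrix.norm_le_iff hδi.le).2 fun i j => ?_
  refine abs_le_of_sq_le_sq ?_ hδi.le
  have h1 := (key i j).trans (hd j)
  have h2 := mul_le_mul_of_nonneg_left h1 hδi.le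
  calc X⁻¹ i j ^ 2 = δ * δ⁻¹ * X⁻¹ i j ^ 2 := by rw [hδ1, one_mul]
    _ ≤ δ⁻¹ ^ 2 := by linarith

theorem UniformlyBddLip.inv {ι X : Type*} [PseudoMetricSpace X] {p : ℕ} {δ : ℝ} (hδ : 0 < δ)
    {φ : ι → X → Matrix (Fin p) (Fin p) ℝ} (hφ : UniformlyBddLip φ)
    (h : ∀ i x, (φ i x - δ • (1 : Matrix (Fin p) (Fin p) ℝ)).PosSemidef) :
    UniformlyBddLip (fun i x => (φ i x)⁻¹) := by
  obtain ⟨K, hK, hb, hl⟩ := hφ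
  have hi : ∀ i x, ‖(φ i x)⁻¹‖ ≤ δ⁻¹ := fun i x => norm_inv_le_of_coercive hδ (h i x)
  refine ⟨max δ⁻¹ (p * (p * δ⁻¹ * K) * δ⁻¹), by positivity,
    fun i x => (hi i x).trans (le_max_left _ _), fun i x y => ?_⟩
  have hu : IsUnit (φ i x) ↔ IsUnit (φ i y) :=
    iff_of_true (isUnit_of_coercive hδ (h i x)) (isUnit_of_coercive hδ (h i y))
  rw [Matrix.inv_sub_inv hu]
  calc ‖(φ i x)⁻¹ * (φ i y - φ i x) * (φ i y)⁻¹‖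
      ≤ p * (p * ‖(φ i x)⁻¹‖ * ‖φ i y - φ i x‖) * ‖(φ i y)⁻¹‖ := by
        refine (norm_matrix_mul_le _ _).trans ?_
        gcongr
        exact norm_matrix_mul_le _ _
    _ ≤ p * (p * δ⁻¹ * (K * dist x y)) * δ⁻¹ := by
        gcongr
        · exact hi i x
        · rw [norm_sub_rev]; exact hl i x y
        · exact hi i y
    _ = (p * (p * δ⁻¹ * K) * δ⁻¹) * dist x y := by ring
    _ ≤ _ := by gcongr; exact le_max_right _ _

/-! ### The cone of positive semidefinite matrices -/

/-- The cone `S^p_+` of positive semidefinite real matrices, as a set. -/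
def psdCone (p : ℕ) : Set (Matrix (Fin p) (Fin p) ℝ) := {M | M.PosSemidef}

theorem isClosed_psdCone (p : ℕ) : IsClosed (psdCone p) := by
  have : psdCone p = {M | Mᵀ = M} ∩ ⋂ x : Fin p → ℝ, {M | 0 ≤ x ⬝ᵥ (M *ᵥ x)} := by
    ext M
    simp only [psdCone, mem_ofPred_eq, mem_inter_iff, mem_iInter]
    exact ⟨fun h => ⟨h.isSymm_real, h.dotProduct_nonneg_real⟩,
      fun h => Matrix.posSemidef_of_real h.1 h.2⟩
  rw [this]
  refine (isClosed_eq (by fun_prop) continuous_id).inter (isClosed_iInter fun x => ?_)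
  refine isClosed_le continuous_const ?_
  fun_prop

theorem psdCone_nonempty (p : ℕ) : (psdCone p).Nonempty := ⟨0, Matrix.PosSemidef.zero⟩

theorem exists_psd_norm_sub_eq {p : ℕ} (M : Matrix (Fin p) (Fin p) ℝ) :
    ∃ S : Matrix (Fin p) (Fin p) ℝ, S.PosSemidef ∧ ‖M - S‖ = Metric.infDist M (psdCone p) := by
  obtain ⟨S, hS, h⟩ := (isClosed_psdCone p).exists_infDist_eq_dist (psdCone_nonempty p) M
  exact ⟨S, hS, by rw [h, dist_eq_norm]⟩

theorem infDist_psdCone_le {p : ℕ} {M S : Matrix (Fin p) (Fin p) ℝ} (hS : S.PosSemidef) :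
    Metric.infDist M (psdCone p) ≤ ‖M - S‖ := by
  rw [← dist_eq_norm]
  exact Metric.infDist_le_dist_of_mem hS

theorem posSemidef_of_infDist_nonpos {p : ℕ} {M : Matrix (Fin p) (Fin p) ℝ}
    (h : Metric.infDist M (psdCone p) ≤ 0) : M.PosSemidef :=
  ((isClosed_psdCone p).mem_iff_infDist_zero (psdCone_nonempty p)).2
    (le_antisymm h Metric.infDist_nonneg)

theorem Matrix.PosSemidef.norm_le_trace {p : ℕ} {M : Matrix (Fin p) (Fin p) ℝ}
    (h : M.PosSemidef) : ‖M‖ ≤ M.trace := by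
  have hd : ∀ i, M i i ≤ M.trace := fun i =>
    Finset.single_le_sum (f := fun k => M k k) (fun k _ => h.diag_nonneg) (Finset.mem_univ i)
  refine (Matrix.norm_le_iff h.trace_nonneg).2 fun i j => ?_
  -- test with `e_i ± e_j`
  have key : ∀ a : ℝ, 0 ≤ M i i + a * M i j + a * M j i + a ^ 2 * M j j := by
    intro a
    have := h.dotProduct_nonneg_real (Pi.single i 1 + a • Pi.single j 1)
    simp only [Matrix.mulVec_add, Matrix.mulVec_smul, Matrix.mulVec_single_one, dotProduct_add,
      add_dotProduct, smul_dotProduct, dotProduct_smul, single_one_dotProduct,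
      Matrix.col_apply, smul_eq_mul] at this
    linarith
  have hs : M j i = M i j := h.isSymm_real.apply i j
  have h1 := key 1
  have h2 := key (-1)
  have h3 := hd i
  have h4 := hd j
  rw [hs] at h1 h2
  rw [Real.norm_eq_abs, abs_le]
  constructor <;> linarith

theorem abs_trace_le {p : ℕ} (M : Matrix (Fin p) (Fin p) ℝ) : |M.trace| ≤ p * ‖M‖ := by
  refine (Finset.abs_sum_le_sum_abs _ _).trans ?_
  refine (Finset.sum_le_card_nsmul _ _ ‖M‖ fun l _ => ?_).trans (by simp)
  exact Matrix.norm_entry_le_entrywise_sup_norm M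

theorem trace_mono {p : ℕ} {M N : Matrix (Fin p) (Fin p) ℝ} (h : (N - M).PosSemidef) :
    M.trace ≤ N.trace := by
  have := h.trace_nonneg
  rw [Matrix.trace_sub] at this
  linarith

theorem posSemidef_add_smul_one {p : ℕ} {E : Matrix (Fin p) (Fin p) ℝ} (hE : E.IsSymm) {d : ℝ}
    (hd : ‖E‖ ≤ d) : (E + (p * d) • (1 : Matrix (Fin p) (Fin p) ℝ)).PosSemidef := by
  refine Matrix.posSemidef_of_real (hE.add (Matrix.isSymm_one.smul _)) fun x => ?_
  have h1 : |x ⬝ᵥ (E *ᵥ x)| ≤ d * (∑ i, |x i|) ^ 2 := by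
    rw [sq, Finset.sum_mul_sum, Finset.mul_sum]
    simp only [dotProduct, Matrix.mulVec, Finset.mul_sum]
    refine (Finset.abs_sum_le_sum_abs _ _).trans (Finset.sum_le_sum fun i _ => ?_)
    refine (Finset.abs_sum_le_sum_abs _ _).trans (Finset.sum_le_sum fun j _ => ?_)
    have : |E i j| ≤ d := (Matrix.norm_entry_le_entrywise_sup_norm E).trans hd
    rw [abs_mul, abs_mul]
    calc |x i| * (|E i j| * |x j|) = |E i j| * (|x i| * |x j|) := by ring
      _ ≤ d * (|x i| * |x j|) := by gcongr
  have h2 : (∑ i, |x i|) ^ 2 ≤ p * ∑ i, x i * x i := by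
    have := sq_sum_le_card_mul_sum_sq (s := Finset.univ) (f := fun i => |x i|)
    simpa [sq_abs, sq] using this
  have hd0 : 0 ≤ d := (norm_nonneg _).trans hd
  rw [Matrix.add_mulVec, Matrix.smul_mulVec, Matrix.one_mulVec, dotProduct_add, dotProduct_smul,
    smul_eq_mul]
  have h3 := neg_le_of_abs_le h1
  have h4 : d * (∑ i, |x i|) ^ 2 ≤ d * (p * ∑ i, x i * x i) := by gcongr
  have h5 : x ⬝ᵥ x = ∑ i, x i * x i := rfl
  rw [h5]
  nlinarith

/-! ### Lipschitz truncations -/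

/-- The radial truncation `x ↦ (M / max M ‖x‖) x`, which is the identity on the ball of radius `M`
and takes its values in that ball. -/
noncomputable def radialCut {E : Type*} [NormedAddCommGroup E] [NormedSpace ℝ E] (M : ℝ) (x : E) :
    E :=
  (M / max M ‖x‖) • x

theorem div_max_mem_Ioc {M : ℝ} (hM : 0 < M) (r : ℝ) : M / max M r ∈ Ioc (0 : ℝ) 1 := by
  have h : 0 < max M r := hM.trans_le (le_max_left _ _)
  exact ⟨by positivity, (div_le_one h).2 (le_max_left _ _)⟩

section RadialCut

variable {E : Type*} [NormedAddCommGroup E] [NormedSpace ℝ E] {M : ℝ}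

theorem radialCut_of_norm_le (hM : 0 < M) {x : E} (hx : ‖x‖ ≤ M) : radialCut M x = x := by
  rw [radialCut, max_eq_left hx, div_self hM.ne', one_smul]

theorem norm_radialCut_le (hM : 0 < M) (x : E) : ‖radialCut M x‖ ≤ M := by
  have h : 0 < max M ‖x‖ := hM.trans_le (le_max_left _ _)
  rw [radialCut, norm_smul, Real.norm_eq_abs, abs_of_pos (by positivity), div_mul_eq_mul_div,
    div_le_iff₀ h]
  gcongr
  exact le_max_right _ _

theorem norm_radialCut_le_norm (hM : 0 < M) (x : E) : ‖radialCut M x‖ ≤ ‖x‖ := by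
  obtain ⟨h0, h1⟩ := div_max_mem_Ioc hM ‖x‖
  rw [radialCut, norm_smul, Real.norm_eq_abs, abs_of_pos h0]
  exact mul_le_of_le_one_left (norm_nonneg _) h1

theorem norm_radialCut_sub_le (hM : 0 < M) (x y : E) :
    ‖radialCut M x - radialCut M y‖ ≤ 2 * ‖x - y‖ := by
  obtain ⟨h0, h1⟩ := div_max_mem_Ioc hM ‖x‖
  have hx : 0 < max M ‖x‖ := hM.trans_le (le_max_left _ _)
  have hy : 0 < max M ‖y‖ := hM.trans_le (le_max_left _ _)
  have e : radialCut M x - radialCut M y =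
      (M / max M ‖x‖) • (x - y) + (M / max M ‖x‖ - M / max M ‖y‖) • y := by
    simp only [radialCut, smul_sub, sub_smul]; abel
  have e2 : M / max M ‖x‖ - M / max M ‖y‖ =
      (max M ‖y‖ - max M ‖x‖) * (M / max M ‖x‖) / max M ‖y‖ := by field
  have h3 : |max M ‖y‖ - max M ‖x‖| ≤ ‖x - y‖ := by
    refine (abs_max_sub_max_le_max _ _ _ _).trans ?_
    rw [sub_self, abs_zero, max_eq_right (abs_nonneg _), norm_sub_rev]
    exact abs_norm_sub_norm_le _ _
  rw [e, two_mul]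
  refine norm_add_le_of_le ?_ ?_
  · rw [norm_smul, Real.norm_eq_abs, abs_of_pos h0]
    exact mul_le_of_le_one_left (norm_nonneg _) h1
  · rw [norm_smul, e2, Real.norm_eq_abs, abs_div, abs_mul, abs_of_pos h0, abs_of_pos hy,
      div_mul_eq_mul_div, div_le_iff₀ hy]
    gcongr
    · calc |max M ‖y‖ - max M ‖x‖| * (M / max M ‖x‖) ≤ ‖x - y‖ * 1 := by gcongr
        _ = ‖x - y‖ := mul_one _
    · exact le_max_right _ _

theorem continuous_radialCut (hM : 0 < M) : Continuous (radialCut M : E → E) :=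
  (LipschitzWith.of_dist_le' (K := 2) fun x y => by
    rw [dist_eq_norm, dist_eq_norm]; exact norm_radialCut_sub_le hM x y).continuous

end RadialCut

/-- A Lipschitz retraction of all square matrices onto the positive semidefinite ones: symmetrize,
then add the multiple of the identity that compensates the distance to the cone. -/
noncomputable def psdLift {p : ℕ} (y : Matrix (Fin p) (Fin p) ℝ) : Matrix (Fin p) (Fin p) ℝ :=
  (1 / 2 : ℝ) • (y + yᵀ) +
    (p * Metric.infDist ((1 / 2 : ℝ) • (y + yᵀ)) (psdCone p)) • (1 : Matrix (Fin p) (Fin p) ℝ)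

theorem posSemidef_psdLift {p : ℕ} (y : Matrix (Fin p) (Fin p) ℝ) : (psdLift y).PosSemidef := by
  obtain ⟨S, hS, h⟩ := exists_psd_norm_sub_eq ((1 / 2 : ℝ) • (y + yᵀ))
  have hsym : ((1 / 2 : ℝ) • (y + yᵀ)).IsSymm := by
    rw [Matrix.IsSymm, Matrix.transpose_smul, Matrix.transpose_add, Matrix.transpose_transpose,
      add_comm]
  have := hS.add (posSemidef_add_smul_one (hsym.sub hS.isSymm_real) h.le)
  rwa [← add_assoc, add_sub_cancel] at this

theorem psdLift_of_posSemidef {p : ℕ} {y : Matrix (Fin p) (Fin p) ℝ} (hy : y.PosSemidef) :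
    psdLift y = y := by
  have h : (1 / 2 : ℝ) • (y + yᵀ) = y := by
    rw [hy.isSymm_real.eq, ← two_smul ℝ y, smul_smul]; norm_num
  rw [psdLift, h, Metric.infDist_zero_of_mem (show y ∈ psdCone p from hy), mul_zero, zero_smul,
    add_zero]

theorem norm_psdLift_sub_le {p : ℕ} (x y : Matrix (Fin p) (Fin p) ℝ) :
    ‖psdLift x - psdLift y‖ ≤ (1 + p) * ‖x - y‖ := by
  have hs : ‖(1 / 2 : ℝ) • (x + xᵀ) - (1 / 2 : ℝ) • (y + yᵀ)‖ ≤ ‖x - y‖ := by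
    rw [← smul_sub, add_sub_add_comm, ← Matrix.transpose_sub, norm_smul]
    have := norm_add_le (x - y) (x - y)ᵀ
    rw [Matrix.norm_transpose] at this
    rw [Real.norm_of_nonneg (by norm_num)]
    linarith
  have h1 : ‖(1 : Matrix (Fin p) (Fin p) ℝ)‖ ≤ 1 := by
    refine (Matrix.norm_le_iff zero_le_one).2 fun i j => ?_
    rw [Matrix.one_apply]; split_ifs <;> simp
  have hd := (Metric.lipschitz_infDist_pt (psdCone p)).dist_le_mul
    ((1 / 2 : ℝ) • (x + xᵀ)) ((1 / 2 : ℝ) • (y + yᵀ))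
  rw [NNReal.coe_one, one_mul, dist_eq_norm, dist_eq_norm, Real.norm_eq_abs] at hd
  rw [psdLift, psdLift, add_sub_add_comm, ← sub_smul, ← mul_sub, add_mul, one_mul]
  refine norm_add_le_of_le hs ?_
  rw [norm_smul, norm_mul, Real.norm_natCast, Real.norm_eq_abs]
  calc _ ≤ p * ‖x - y‖ * 1 := by gcongr; exact hd.trans hs
    _ = _ := mul_one _

/-- A bounded Lipschitz map into the positive semidefinite matrices that is the identity on the
positive semidefinite matrices of norm at most `M`. -/
noncomputable def psdCut {p : ℕ} (M : ℝ) (y : Matrix (Fin p) (Fin p) ℝ) :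
    Matrix (Fin p) (Fin p) ℝ :=
  radialCut M (psdLift y)

theorem posSemidef_psdCut {p : ℕ} {M : ℝ} (hM : 0 < M) (y : Matrix (Fin p) (Fin p) ℝ) :
    (psdCut M y).PosSemidef :=
  (posSemidef_psdLift y).smul (div_max_mem_Ioc hM _).1.le

theorem norm_psdCut_sub_le {p : ℕ} {M : ℝ} (hM : 0 < M) (x y : Matrix (Fin p) (Fin p) ℝ) :
    ‖psdCut M x - psdCut M y‖ ≤ 2 * (1 + p) * ‖x - y‖ := by
  refine (norm_radialCut_sub_le hM _ _).trans ?_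
  rw [mul_assoc]
  gcongr
  exact norm_psdLift_sub_le x y

theorem continuous_psdCut {p : ℕ} {M : ℝ} (hM : 0 < M) :
    Continuous (psdCut M : Matrix (Fin p) (Fin p) ℝ → Matrix (Fin p) (Fin p) ℝ) :=
  (LipschitzWith.of_dist_le' (K := 2 * (1 + p)) fun x y => by
    rw [dist_eq_norm, dist_eq_norm]; exact norm_psdCut_sub_le hM x y).continuous

theorem psdCut_of_norm_le {p : ℕ} {M : ℝ} (hM : 0 < M) {y : Matrix (Fin p) (Fin p) ℝ}
    (hy : y.PosSemidef) (h : ‖y‖ ≤ M) : psdCut M y = y := by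
  rw [psdCut, psdLift_of_posSemidef hy, radialCut_of_norm_le hM h]

theorem exists_psdCut_eq_smul {p : ℕ} {M : ℝ} (hM : 0 < M) {y : Matrix (Fin p) (Fin p) ℝ}
    (hy : y.PosSemidef) : ∃ l : ℝ, 0 < l ∧ l ≤ 1 ∧ psdCut M y = l • y :=
  ⟨_, (div_max_mem_Ioc hM ‖y‖).1, (div_max_mem_Ioc hM ‖y‖).2, by
    rw [psdCut, psdLift_of_posSemidef hy, radialCut]⟩

/-! ### Gronwall-type estimates -/

/-- Gronwall's inequality, backward in time, for a function whose left increments are bounded to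
first order. -/
theorem le_gronwallBound_of_backward_slope {f : ℝ → ℝ} {a b K ε : ℝ}
    (hf : ContinuousOn f (Icc a b))
    (h : ∀ s ∈ Ioc a b, ∀ η > 0, ∀ᶠ x in 𝓝[>] (0 : ℝ),
      f (s - x) ≤ f s + x * (K * f s + ε + η)) :
    ∀ s ∈ Icc a b, f s ≤ gronwallBound (f b) K ε (b - s) := by
  intro s hs
  have key := le_gronwallBound_of_liminf_deriv_right_le (f := fun z => f (b - z))
    (f' := fun z => K * f (b - z) + ε) (δ := f b) (K := K) (ε := ε) (a := 0) (b := b - a)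
    (hf.comp (by fun_prop) fun z hz => ⟨by linarith [hz.2], by linarith [hz.1]⟩)
    (fun x hx r hr => ?_) (by simp) (fun x _ => le_rfl) (b - s)
    ⟨by linarith [hs.2], by linarith [hs.1]⟩
  · simpa using key
  · apply Eventually.frequently
    have hη : 0 < (r - (K * f (b - x) + ε)) / 2 := by linarith
    have h1 := h (b - x) ⟨by linarith [hx.2], by linarith [hx.1]⟩ _ hη
    have ht : Tendsto (fun z => z - x) (𝓝[>] x) (𝓝[>] 0) := by
      refine tendsto_nhdsWithin_of_tendsto_nhds_of_eventually_within _ ?_ ?_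
      · have : Tendsto (fun z => z - x) (𝓝 x) (𝓝 (x - x)) :=
          (continuous_id.sub continuous_const).tendsto x
        rw [sub_self] at this
        exact this.mono_left nhdsWithin_le_nhds
      · filter_upwards [self_mem_nhdsWithin] with z hz
        exact sub_pos.2 (mem_Ioi.1 hz)
    filter_upwards [ht.eventually h1, self_mem_nhdsWithin] with z hz hzx
    have hpos : 0 < z - x := sub_pos.2 (mem_Ioi.1 hzx)
    rw [sub_sub_sub_cancel_right] at hz
    rw [inv_mul_lt_iff₀ hpos]
    nlinarith

theorem isCompact_triangle (T : ℝ) : IsCompact (triangle T) := by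
  refine (isCompact_Icc.prod isCompact_Icc : IsCompact (Icc (0 : ℝ) T ×ˢ Icc (0 : ℝ) T)).of_isClosed_subset
    ?_ fun p hp => ⟨⟨hp.1, hp.2.1.trans hp.2.2⟩, ⟨hp.1.trans hp.2.1, hp.2.2⟩⟩
  exact (isClosed_le continuous_const continuous_fst).inter
    ((isClosed_le continuous_fst continuous_snd).inter (isClosed_le continuous_snd continuous_const))

/-- If `u` is continuous on the triangle then so are `u t ·` and the diagonal `r ↦ u r r`. -/
theorem ContinuousOn.triangle_slice {E : Type*} [TopologicalSpace E] {T : ℝ} {u : ℝ → ℝ → E}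
    (hu : ContinuousOn (fun p : ℝ × ℝ => u p.1 p.2) (triangle T)) {t s : ℝ}
    (h : (t, s) ∈ triangle T) : ContinuousOn (u t) (Icc s T) :=
  hu.comp (f := fun r => (t, r)) (by fun_prop)
    fun _ hr => ⟨h.1, h.2.1.trans hr.1, hr.2⟩

theorem ContinuousOn.triangle_diag {E : Type*} [TopologicalSpace E] {T : ℝ} {u : ℝ → ℝ → E}
    (hu : ContinuousOn (fun p : ℝ × ℝ => u p.1 p.2) (triangle T)) :
    ContinuousOn (fun r => u r r) (Icc 0 T) :=
  hu.comp (f := fun r => (r, r)) (by fun_prop) fun _ hr => ⟨hr.1, le_rfl, hr.2⟩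

theorem integral_exp_backward (K W T s : ℝ) :
    ∫ r in s..T, 2 * K * W * Real.exp (4 * K * (T - r)) =
      W / 2 * (Real.exp (4 * K * (T - s)) - 1) := by
  have hd : ∀ r ∈ uIcc s T, HasDerivAt (fun r => -(W / 2) * Real.exp (4 * K * (T - r)))
      (2 * K * W * Real.exp (4 * K * (T - r))) r := by
    intro r _
    have h1 : HasDerivAt (fun r => 4 * K * (T - r)) (4 * K * (-1)) r :=
      ((hasDerivAt_id r).const_sub T).const_mul _
    have := h1.exp.const_mul (-(W / 2))
    exact this.congr_deriv (by ring)
  rw [intervalIntegral.integral_eq_sub_of_hasDerivAt hd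
    (Continuous.intervalIntegrable (by fun_prop) _ _)]
  rw [sub_self, mul_zero, Real.exp_zero]
  ring

/-- A Gronwall inequality for kernels on the triangle, in which the diagonal enters. The function
`(t, s) ↦ exp (-4 K (T - s)) d(t, s)` is estimated at its maximum. -/
theorem le_of_le_integral_triangle {T K g : ℝ} (hT : 0 ≤ T) (hK : 0 < K) (hg : 0 ≤ g)
    {d : ℝ → ℝ → ℝ} (hd : ContinuousOn (fun p : ℝ × ℝ => d p.1 p.2) (triangle T))
    (h : ∀ t s, (t, s) ∈ triangle T → d t s ≤ g + ∫ r in s..T, K * (d t r + d r r)) :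
    ∀ t s, (t, s) ∈ triangle T → d t s ≤ 2 * g * Real.exp (4 * K * (T - s)) := by
  have hne : (triangle T).Nonempty := ⟨(0, 0), le_rfl, le_rfl, hT⟩
  obtain ⟨⟨t₀, s₀⟩, h0, hmax⟩ := (isCompact_triangle T).exists_isMaxOn hne
    (f := fun p : ℝ × ℝ => Real.exp (-(4 * K * (T - p.2))) * d p.1 p.2)
    (ContinuousOn.mul (by fun_prop) hd)
  set W := Real.exp (-(4 * K * (T - s₀))) * d t₀ s₀ with hW
  have hle : ∀ t s, (t, s) ∈ triangle T → d t s ≤ W * Real.exp (4 * K * (T - s)) := by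
    intro t s hts
    have h1 : Real.exp (-(4 * K * (T - s))) * d t s ≤ W := hmax hts
    rw [Real.exp_neg, inv_mul_le_iff₀ (Real.exp_pos _)] at h1
    linarith
  have hW2 : W ≤ 2 * g := by
    rcases le_or_gt W 0 with hW0 | hW0
    · linarith
    have h1 := h t₀ s₀ h0
    have hsT : s₀ ≤ T := h0.2.2
    have hc : ContinuousOn (fun r => K * (d t₀ r + d r r)) (Icc s₀ T) :=
      continuousOn_const.mul ((hd.triangle_slice h0).add
        (hd.triangle_diag.mono (Icc_subset_Icc_left (h0.1.trans h0.2.1))))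
    have h2 : ∫ r in s₀..T, K * (d t₀ r + d r r) ≤
        ∫ r in s₀..T, 2 * K * W * Real.exp (4 * K * (T - r)) := by
      refine intervalIntegral.integral_mono_on hsT (hc.intervalIntegrable_of_Icc hsT)
        (Continuous.intervalIntegrable (by fun_prop) _ _) fun r hr => ?_
      have ha := hle t₀ r ⟨h0.1, h0.2.1.trans hr.1, hr.2⟩
      have hb := hle r r ⟨(h0.1.trans h0.2.1).trans hr.1, le_rfl, hr.2⟩
      nlinarith
    rw [integral_exp_backward] at h2
    have he : Real.exp (-(4 * K * (T - s₀))) ≤ 1 := by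
      rw [Real.exp_le_one_iff]
      have : 0 ≤ 4 * K * (T - s₀) := mul_nonneg (by positivity) (by linarith)
      linarith
    have he0 := Real.exp_pos (-(4 * K * (T - s₀)))
    have hee : Real.exp (-(4 * K * (T - s₀))) * Real.exp (4 * K * (T - s₀)) = 1 := by
      rw [← Real.exp_add]; simp
    have h3 : W ≤ Real.exp (-(4 * K * (T - s₀))) *
        (g + W / 2 * (Real.exp (4 * K * (T - s₀)) - 1)) := by
      rw [hW]
      gcongr
      linarith
    nlinarith
  intro t s hts
  exact (hle t s hts).trans (by gcongr)

/-! ### A Volterra equation with a diagonal term -/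

section Volterra

variable {E : Type*} [NormedAddCommGroup E] [NormedSpace ℝ E]

/-- The projection of the real line onto `[0, T]`. -/
noncomputable def clamp (T s : ℝ) : ℝ := max 0 (min s T)

theorem continuous_clamp (T : ℝ) : Continuous (clamp T) := by unfold clamp; fun_prop

theorem clamp_mem {T : ℝ} (hT : 0 ≤ T) (s : ℝ) : clamp T s ∈ Icc 0 T :=
  ⟨le_max_left _ _, max_le hT (min_le_right _ _)⟩

theorem clamp_of_mem {T s : ℝ} (hs : s ∈ Icc 0 T) : clamp T s = s := by
  rw [clamp, min_eq_left hs.2, max_eq_right hs.1]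

theorem clamp_mono {T : ℝ} : Monotone (clamp T) := fun _ _ h =>
  max_le_max le_rfl (min_le_min h le_rfl)

theorem continuous_integral_clamp {T K : ℝ} (hT : 0 ≤ T) {F : ℝ → ℝ → E}
    (hmeas : ∀ t, AEStronglyMeasurable (F t) volume) (hb : ∀ t r, ‖F t r‖ ≤ K)
    (hc : ∀ r, Continuous fun t => F t r) :
    Continuous fun p : ℝ × ℝ => ∫ r in clamp T p.2..T, F p.1 r := by
  rw [continuous_iff_continuousAt]
  rintro ⟨t₀, s₀⟩
  have hmem := clamp_mem hT s₀
  have key := intervalIntegral.continuousAt_parametric_primitive_of_dominated (μ := volume)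
    (F := F) (fun _ => K) (-1) (T + 1) (a₀ := T) (b₀ := clamp T s₀) (x₀ := t₀)
    (fun t => (hmeas t).restrict) (.of_forall fun t => .of_forall fun r => hb t r)
    (by simp) (.of_forall fun r => (hc r).continuousAt)
    ⟨by linarith, by linarith⟩ ⟨by linarith [hmem.1], by linarith [hmem.2]⟩ (by simp)
  have h2 : ContinuousAt (fun p : ℝ × ℝ => (p.1, clamp T p.2)) (t₀, s₀) :=
    (continuous_fst.prodMk ((continuous_clamp T).comp continuous_snd)).continuousAt
  have h3 := (ContinuousAt.comp (f := fun p : ℝ × ℝ => (p.1, clamp T p.2)) (x := (t₀, s₀))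
    key h2).neg
  refine h3.congr (.of_forall fun p => ?_)
  exact (intervalIntegral.integral_symm _ _).symm

/-- Global existence for `P(t, s) = G(t) + ∫_s^T f(t, r, P(t, r), P(r, r)) dr` with bounded,
Lipschitz `f`. The map is a contraction for the sup norm of `exp (-4 K (T - s)) P(t, s)`, so the
fixed point is sought in the weighted unknown. -/
theorem exists_volterra_solution [CompleteSpace E] {T K : ℝ} (hT : 0 ≤ T) (hK : 0 < K)
    {G : ℝ → E} (hG : Continuous G) (hGb : ∀ t, ‖G t‖ ≤ K) {f : ℝ → ℝ → E → E → E}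
    (hmeas : ∀ t (u v : ℝ → E), Continuous u → Continuous v →
      AEStronglyMeasurable (fun r => f t r (u r) (v r)) volume)
    (hcont : ∀ r, Continuous fun q : ℝ × E × E => f q.1 r q.2.1 q.2.2)
    (hb : ∀ t r x y, ‖f t r x y‖ ≤ K)
    (hl : ∀ t r x y x' y', ‖f t r x y - f t r x' y'‖ ≤ K * (‖x - x'‖ + ‖y - y'‖)) :
    ∃ P : ℝ → ℝ → E, Continuous (fun p : ℝ × ℝ => P p.1 p.2) ∧
      ∀ t, ∀ s ∈ Icc 0 T, P t s = G t + ∫ r in s..T, f t r (P t r) (P r r) := by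
  let e : ℝ → ℝ := fun s => Real.exp (4 * K * (T - clamp T s))
  have he : Continuous e := by
    have := continuous_clamp T
    fun_prop
  have he0 : ∀ s, 0 < e s := fun s => Real.exp_pos _
  have he1 : ∀ s, 1 ≤ e s := fun s => Real.one_le_exp
    (mul_nonneg (by positivity) (by linarith [(clamp_mem hT s).2]))
  let F : (ℝ × ℝ → E) → ℝ → ℝ → E := fun U t r => f t r (e r • U (t, r)) (e r • U (r, r))
  have hFm : ∀ U : ℝ × ℝ → E, Continuous U → ∀ t, AEStronglyMeasurable (F U t) volume :=
    fun U hU t => hmeas t _ _ (by fun_prop) (by fun_prop)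
  have hFc : ∀ U : ℝ × ℝ → E, Continuous U → ∀ r, Continuous fun t => F U t r := fun U hU r =>
    (hcont r).comp (f := fun t => (t, e r • U (t, r), e r • U (r, r))) (by fun_prop)
  have hFi : ∀ U : ℝ × ℝ → E, Continuous U → ∀ t a b, IntervalIntegrable (F U t) volume a b := by
    intro U hU t a b
    refine (intervalIntegrable_const (c := K)).mono_fun (hFm U hU t).restrict
      (.of_forall fun r => ?_)
    rw [Real.norm_of_nonneg hK.le]
    exact hb _ _ _ _
  let Ψ : (ℝ × ℝ → E) → ℝ × ℝ → E := fun U p =>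
    (e p.2)⁻¹ • (G p.1 + ∫ r in clamp T p.2..T, F U p.1 r)
  have hΨc : ∀ U : ℝ × ℝ → E, Continuous U → Continuous (Ψ U) := by
    intro U hU
    have h1 := continuous_integral_clamp hT (hFm U hU) (fun t r => hb _ _ _ _) (hFc U hU)
    have h2 : Continuous fun p : ℝ × ℝ => (e p.2)⁻¹ :=
      (he.comp continuous_snd).inv₀ fun p => (he0 _).ne'
    exact h2.smul ((hG.comp continuous_fst).add h1)
  have hΨb : ∀ U p, ‖Ψ U p‖ ≤ K + K * T := by
    intro U p
    have hm := clamp_mem hT p.2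
    have h1 : ‖∫ r in clamp T p.2..T, F U p.1 r‖ ≤ K * |T - clamp T p.2| :=
      intervalIntegral.norm_integral_le_of_norm_le_const fun r _ => hb _ _ _ _
    rw [abs_of_nonneg (by linarith [hm.2])] at h1
    rw [norm_smul, norm_inv, Real.norm_of_nonneg (he0 _).le]
    refine (mul_le_of_le_one_left (norm_nonneg _) (inv_le_one_of_one_le₀ (he1 _))).trans ?_
    refine norm_add_le_of_le (hGb _) (h1.trans ?_)
    gcongr
    linarith [hm.1]
  let Φ : BoundedContinuousFunction (ℝ × ℝ) E → BoundedContinuousFunction (ℝ × ℝ) E := fun U =>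
    BoundedContinuousFunction.ofNormedAddCommGroup (Ψ U) (hΨc U U.continuous) _ (hΨb U)
  have hΦ : ContractingWith (1 / 2 : NNReal) Φ := by
    refine ⟨by norm_num, LipschitzWith.of_dist_le_mul fun U V => ?_⟩
    refine (BoundedContinuousFunction.dist_le (by positivity)).2 fun p => ?_
    have hm := clamp_mem hT p.2
    change dist (Ψ U p) (Ψ V p) ≤ _
    rw [dist_eq_norm, ← smul_sub, add_sub_add_left_eq_sub,
      ← intervalIntegral.integral_sub (hFi U U.continuous _ _ _) (hFi V V.continuous _ _ _),
      norm_smul, norm_inv, Real.norm_of_nonneg (he0 _).le, inv_mul_le_iff₀ (he0 _)]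
    have h1 : ‖∫ r in clamp T p.2..T, (F U p.1 r - F V p.1 r)‖ ≤
        ∫ r in clamp T p.2..T, 2 * K * dist U V * Real.exp (4 * K * (T - r)) := by
      refine intervalIntegral.norm_integral_le_of_norm_le hm.2 (.of_forall fun r hr => ?_)
        (Continuous.intervalIntegrable (by fun_prop) _ _)
      refine (hl _ _ _ _ _ _).trans ?_
      have hr' : clamp T r = r := clamp_of_mem ⟨hm.1.trans hr.1.le, hr.2⟩
      have hd : ∀ q, ‖e r • U q - e r • V q‖ ≤ Real.exp (4 * K * (T - r)) * dist U V := by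
        intro q
        rw [← smul_sub, norm_smul, Real.norm_of_nonneg (he0 _).le, ← dist_eq_norm]
        simp only [e, hr']
        gcongr
        exact BoundedContinuousFunction.dist_coe_le_dist q
      nlinarith [hd (p.1, r), hd (r, r)]
    rw [integral_exp_backward] at h1
    refine h1.trans ?_
    simp only [e]
    have : 0 ≤ dist U V := dist_nonneg
    push_cast
    nlinarith
  obtain ⟨U, hU⟩ : ∃ U, Φ U = U := ⟨_, hΦ.fixedPoint_isFixedPt⟩
  refine ⟨fun t s => e s • U (t, s), by fun_prop, fun t s hs => ?_⟩
  have h1 : Ψ U (t, s) = U (t, s) := by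
    conv_rhs => rw [← hU]
    rfl
  change e s • U (t, s) = _
  rw [← h1]
  simp only [Ψ, smul_inv_smul₀ (he0 _).ne', clamp_of_mem hs]
  rfl

end Volterra

/-! ### Integrals of matrix-valued functions -/

theorem stronglyMeasurable_matrix_mul {p q k : ℕ} {F : ℝ → Matrix (Fin p) (Fin q) ℝ}
    {F' : ℝ → Matrix (Fin q) (Fin k) ℝ} (hF : StronglyMeasurable F)
    (hF' : StronglyMeasurable F') : StronglyMeasurable fun r => F r * F' r :=
  (show Continuous fun z : Matrix (Fin p) (Fin q) ℝ × Matrix (Fin q) (Fin k) ℝ => z.1 * z.2 by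
    fun_prop).comp_stronglyMeasurable (hF.prodMk hF')

theorem stronglyMeasurable_matrix_transpose {p q : ℕ} {F : ℝ → Matrix (Fin p) (Fin q) ℝ}
    (hF : StronglyMeasurable F) : StronglyMeasurable fun r => (F r)ᵀ :=
  (show Continuous fun z : Matrix (Fin p) (Fin q) ℝ => zᵀ by
    fun_prop).comp_stronglyMeasurable hF

theorem stronglyMeasurable_matrix_inv {p : ℕ} {F : ℝ → Matrix (Fin p) (Fin p) ℝ}
    (hF : StronglyMeasurable F) : StronglyMeasurable fun r => (F r)⁻¹ := by
  simp only [Matrix.inv_def, Ring.inverse_eq_inv']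
  have h1 : StronglyMeasurable fun r => (F r).det :=
    (show Continuous fun z : Matrix (Fin p) (Fin p) ℝ => z.det by
      fun_prop).comp_stronglyMeasurable hF
  have h2 : StronglyMeasurable fun r => (F r).adjugate :=
    (show Continuous fun z : Matrix (Fin p) (Fin p) ℝ => z.adjugate by
      fun_prop).comp_stronglyMeasurable hF
  exact h1.measurable.inv.stronglyMeasurable.smul h2

theorem intervalIntegrable_of_norm_le {E : Type*} [NormedAddCommGroup E] {F : ℝ → E} {K : ℝ}
    (hF : StronglyMeasurable F) (hb : ∀ r, ‖F r‖ ≤ K) (a b : ℝ) :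
    IntervalIntegrable F volume a b := by
  refine (intervalIntegrable_const (c := K)).mono_fun hF.aestronglyMeasurable
    (.of_forall fun r => ?_)
  exact (hb r).trans (le_abs_self K)

theorem integral_matrix_apply {p q : ℕ} {F : ℝ → Matrix (Fin p) (Fin q) ℝ} {a b : ℝ}
    (hF : IntervalIntegrable F volume a b) (i : Fin p) (j : Fin q) :
    (∫ r in a..b, F r) i j = ∫ r in a..b, F r i j :=
  ((LinearMap.toContinuousLinearMap
    (Matrix.entryLinearMap ℝ ℝ i j)).intervalIntegral_comp_comm hF).symm

theorem intervalIntegrable_matrix_apply {p q : ℕ} {F : ℝ → Matrix (Fin p) (Fin q) ℝ} {a b : ℝ}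
    (hF : IntervalIntegrable F volume a b) (i : Fin p) (j : Fin q) :
    IntervalIntegrable (fun r => F r i j) volume a b :=
  let e := LinearMap.toContinuousLinearMap (Matrix.entryLinearMap ℝ ℝ i j : _ →ₗ[ℝ] ℝ)
  ⟨e.integrable_comp hF.1, e.integrable_comp hF.2⟩

theorem integral_trace {p : ℕ} {F : ℝ → Matrix (Fin p) (Fin p) ℝ} {a b : ℝ}
    (hF : IntervalIntegrable F volume a b) :
    (∫ r in a..b, F r).trace = ∫ r in a..b, (F r).trace :=
  ((LinearMap.toContinuousLinearMap
    (Matrix.traceLinearMap (Fin p) ℝ ℝ)).intervalIntegral_comp_comm hF).symm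

theorem intervalIntegrable_trace {p : ℕ} {F : ℝ → Matrix (Fin p) (Fin p) ℝ} {a b : ℝ}
    (hF : IntervalIntegrable F volume a b) :
    IntervalIntegrable (fun r => (F r).trace) volume a b :=
  let e := LinearMap.toContinuousLinearMap (Matrix.traceLinearMap (Fin p) ℝ ℝ)
  ⟨e.integrable_comp hF.1, e.integrable_comp hF.2⟩

theorem posSemidef_integral {p : ℕ} {F : ℝ → Matrix (Fin p) (Fin p) ℝ} {a b : ℝ} (hab : a ≤ b)
    (hF : IntervalIntegrable F volume a b) (h : ∀ r ∈ Icc a b, (F r).PosSemidef) :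
    (∫ r in a..b, F r).PosSemidef := by
  refine Matrix.posSemidef_of_real ?_ fun x => ?_
  · ext i j
    rw [Matrix.transpose_apply, integral_matrix_apply hF, integral_matrix_apply hF]
    refine intervalIntegral.integral_congr fun r hr => ?_
    rw [uIcc_of_le hab] at hr
    exact (h r hr).isSymm_real.apply i j
  · let φ : Matrix (Fin p) (Fin p) ℝ →ₗ[ℝ] ℝ :=
      { toFun := fun M => x ⬝ᵥ (M *ᵥ x)
        map_add' := fun M N => by rw [Matrix.add_mulVec, dotProduct_add]
        map_smul' := fun c M => by rw [Matrix.smul_mulVec, dotProduct_smul]; rfl }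
    have h1 := (LinearMap.toContinuousLinearMap φ).intervalIntegral_comp_comm hF
    change 0 ≤ LinearMap.toContinuousLinearMap φ (∫ r in a..b, F r)
    rw [← h1]
    exact intervalIntegral.integral_nonneg hab fun r hr => (h r hr).dotProduct_nonneg_real x

/-! ### Positivity for Lyapunov equations -/

/-- The Lyapunov operator `P ↦ P A + Aᵀ P + Cᵀ P C`. -/
def lyapunov {n : ℕ} (A C P : Matrix (Fin n) (Fin n) ℝ) : Matrix (Fin n) (Fin n) ℝ :=
  P * A + Aᵀ * P + Cᵀ * P * C

theorem lyapunov_sub {n : ℕ} (A C P P' : Matrix (Fin n) (Fin n) ℝ) :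
    lyapunov A C (P - P') = lyapunov A C P - lyapunov A C P' := by
  simp only [lyapunov, Matrix.sub_mul, Matrix.mul_sub]
  abel

theorem norm_transpose_mul_mul_le {n : ℕ} {C P : Matrix (Fin n) (Fin n) ℝ} {K : ℝ}
    (hC : ‖C‖ ≤ K) : ‖Cᵀ * P * C‖ ≤ n * n * K * K * ‖P‖ := by
  have hK : 0 ≤ K := (norm_nonneg _).trans hC
  calc ‖Cᵀ * P * C‖ ≤ n * (n * ‖C‖ * ‖P‖) * ‖C‖ := by
        refine (norm_matrix_mul_le _ _).trans ?_
        gcongr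
        refine (norm_matrix_mul_le _ _).trans ?_
        rw [Matrix.norm_transpose]
    _ ≤ n * (n * K * ‖P‖) * K := by gcongr
    _ = _ := by ring

theorem norm_lyapunov_le {n : ℕ} {A C P : Matrix (Fin n) (Fin n) ℝ} {K : ℝ} (hA : ‖A‖ ≤ K)
    (hC : ‖C‖ ≤ K) : ‖lyapunov A C P‖ ≤ (2 * n * K + n * n * K * K) * ‖P‖ := by
  have hK : 0 ≤ K := (norm_nonneg _).trans hA
  have h1 : ‖P * A‖ ≤ n * ‖P‖ * K := (norm_matrix_mul_le _ _).trans (by gcongr)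
  have h2 : ‖Aᵀ * P‖ ≤ n * K * ‖P‖ := (norm_matrix_mul_le _ _).trans (by
    rw [Matrix.norm_transpose]; gcongr)
  have h3 := norm_transpose_mul_mul_le (P := P) hC
  refine (norm_add_le_of_le (norm_add_le_of_le h1 h2) h3).trans (le_of_eq ?_)
  ring

theorem stronglyMeasurable_lyapunov {n : ℕ} {A C P : ℝ → Matrix (Fin n) (Fin n) ℝ}
    (hA : StronglyMeasurable A) (hC : StronglyMeasurable C) (hP : StronglyMeasurable P) :
    StronglyMeasurable fun r => lyapunov (A r) (C r) (P r) :=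
  ((stronglyMeasurable_matrix_mul hP hA).add
    (stronglyMeasurable_matrix_mul (stronglyMeasurable_matrix_transpose hA) hP)).add
    (stronglyMeasurable_matrix_mul
      (stronglyMeasurable_matrix_mul (stronglyMeasurable_matrix_transpose hC) hP) hC)

/-- One step of the Lyapunov flow, with the second-order term that completes it to a positive
map: it equals `h⁻¹ (1 + h A)ᵀ S (1 + h A) + Cᵀ S C`. -/
theorem posSemidef_lyapunov_step {n : ℕ} {S : Matrix (Fin n) (Fin n) ℝ} (hS : S.PosSemidef)
    (A C : Matrix (Fin n) (Fin n) ℝ) {h : ℝ} (hh : 0 < h) :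
    (h⁻¹ • S + (lyapunov A C S + h • (Aᵀ * S * A))).PosSemidef := by
  have h1 := (hS.transpose_mul_mul (1 + h • A)).smul (inv_pos.2 hh).le
  have h2 := hS.transpose_mul_mul C
  convert h1.add h2 using 1
  rw [Matrix.transpose_add, Matrix.transpose_one, Matrix.transpose_smul]
  simp only [Matrix.add_mul, Matrix.mul_add, Matrix.one_mul, Matrix.mul_one, Matrix.smul_mul,
    Matrix.mul_smul, smul_add, smul_smul, inv_mul_cancel₀ hh.ne', one_smul, lyapunov]
  rw [show h⁻¹ * (h * h) = h by field]
  abel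

/-- The linear Lyapunov equation with positive semidefinite terminal value and source has a
positive semidefinite solution: the distance of `P s` to the cone satisfies a Gronwall
inequality, because over a short time the flow is a positive map up to second order. -/
theorem posSemidef_of_lyapunov_eq {n : ℕ} {a T K : ℝ} {A C P S : ℝ → Matrix (Fin n) (Fin n) ℝ}
    {G : Matrix (Fin n) (Fin n) ℝ} (hA : StronglyMeasurable A) (hC : StronglyMeasurable C)
    (hAb : ∀ r, ‖A r‖ ≤ K) (hCb : ∀ r, ‖C r‖ ≤ K) (hP : Continuous P)
    (hSi : ∀ u v, IntervalIntegrable S volume u v) (hS : ∀ r, (S r).PosSemidef)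
    (hG : G.PosSemidef)
    (heq : ∀ s ∈ Icc a T, P s = G + ∫ r in s..T, (lyapunov (A r) (C r) (P r) + S r)) :
    ∀ s ∈ Icc a T, (P s).PosSemidef := by
  have hK : 0 ≤ K := (norm_nonneg _).trans (hAb 0)
  set L : ℝ := 2 * n * K + n * n * K * K with hL
  have hL0 : 0 ≤ L := by positivity
  have hLP : ∀ u v, IntervalIntegrable (fun r => lyapunov (A r) (C r) (P r)) volume u v := by
    intro u v
    obtain ⟨N, hN⟩ := (isCompact_uIcc (a := u) (b := v)).exists_bound_of_continuousOn
      hP.continuousOn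
    refine (intervalIntegrable_const (c := L * N)).mono_fun'
      (stronglyMeasurable_lyapunov hA hC hP.stronglyMeasurable).aestronglyMeasurable ?_
    refine (ae_restrict_iff' measurableSet_uIoc).2 (.of_forall fun r hr => ?_)
    exact (norm_lyapunov_le (hAb r) (hCb r)).trans
      (mul_le_mul_of_nonneg_left (hN r (uIoc_subset_uIcc hr)) hL0)
  have hcone : ∀ s ∈ Icc a T, Metric.infDist (P s) (psdCone n) ≤
      gronwallBound (Metric.infDist (P T) (psdCone n)) L 0 (T - s) := by
    refine le_gronwallBound_of_backward_slope
      ((Metric.continuous_infDist_pt _).comp hP).continuousOn fun s hs η hη => ?_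
    obtain ⟨S₀, hS₀, hdist⟩ := exists_psd_norm_sub_eq (P s)
    set ν := Metric.infDist (P s) (psdCone n) with hν
    set c : ℝ := n * n * K * K * ‖S₀‖ with hc
    have hc0 : 0 ≤ c := by positivity
    -- both error terms `L ‖P r - P s‖` and `x c` stay below `η / 2` near `s`
    have hε : 0 < η / (2 * (L + 1)) := by positivity
    obtain ⟨ρ, hρ, hcont⟩ := Metric.continuous_iff.1 hP s _ hε
    have hmin : 0 < min ρ (min (s - a) (η / (2 * (c + 1)))) :=
      lt_min hρ (lt_min (sub_pos.2 hs.1) (by positivity))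
    filter_upwards [Ioo_mem_nhdsGT hmin] with x hx
    have hx0 : 0 < x := hx.1
    have hxρ : x < ρ := hx.2.trans_le (min_le_left _ _)
    have hxa : x < s - a := hx.2.trans_le ((min_le_right _ _).trans (min_le_left _ _))
    have hxc : x < η / (2 * (c + 1)) :=
      hx.2.trans_le ((min_le_right _ _).trans (min_le_right _ _))
    have hsx : s - x ≤ s := by linarith
    have hxc' : x * c ≤ η / 2 := by
      rw [lt_div_iff₀ (by positivity)] at hxc
      nlinarith
    have hstep : P (s - x) = P s + ∫ r in (s - x)..s, (lyapunov (A r) (C r) (P r) + S r) := by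
      rw [heq (s - x) ⟨by linarith, by linarith [hs.2]⟩, heq s ⟨hs.1.le, hs.2⟩, add_assoc,
        add_comm (∫ r in s..T, _), intervalIntegral.integral_add_adjacent_intervals
        ((hLP _ _).add (hSi _ _)) ((hLP _ _).add (hSi _ _))]
    have hLS : ∀ u v, IntervalIntegrable
        (fun r => lyapunov (A r) (C r) S₀ + x • ((A r)ᵀ * S₀ * A r)) volume u v := by
      refine intervalIntegrable_of_norm_le (K := L * ‖S₀‖ + x * c) ?_ fun r => ?_
      · refine (stronglyMeasurable_lyapunov hA hC stronglyMeasurable_const).add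
          (StronglyMeasurable.const_smul ?_ x)
        exact stronglyMeasurable_matrix_mul (stronglyMeasurable_matrix_mul
          (stronglyMeasurable_matrix_transpose hA) stronglyMeasurable_const) hA
      · refine norm_add_le_of_le (norm_lyapunov_le (hAb r) (hCb r)) ?_
        rw [norm_smul, Real.norm_of_nonneg hx0.le]
        gcongr
        exact norm_transpose_mul_mul_le (hAb r)
    set Z := ∫ r in (s - x)..s,
      (x⁻¹ • S₀ + (lyapunov (A r) (C r) S₀ + x • ((A r)ᵀ * S₀ * A r)) + S r) with hZ
    have hZpsd : Z.PosSemidef :=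
      posSemidef_integral hsx ((intervalIntegrable_const.add (hLS _ _)).add (hSi _ _))
        fun r _ => (posSemidef_lyapunov_step hS₀ (A r) (C r) hx0).add (hS r)
    have hZ2 : Z = S₀ + ∫ r in (s - x)..s,
        (lyapunov (A r) (C r) S₀ + x • ((A r)ᵀ * S₀ * A r) + S r) := by
      rw [hZ]
      simp only [add_assoc]
      rw [intervalIntegral.integral_add intervalIntegrable_const
        (by simpa only [add_assoc] using (hLS _ _).add (hSi _ _)),
        intervalIntegral.integral_const, sub_sub_cancel, smul_inv_smul₀ hx0.ne']
    have hdiff : P (s - x) - Z = (P s - S₀) + ∫ r in (s - x)..s,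
        (lyapunov (A r) (C r) (P r - S₀) - x • ((A r)ᵀ * S₀ * A r)) := by
      rw [hstep, hZ2, add_sub_add_comm,
        ← intervalIntegral.integral_sub ((hLP _ _).add (hSi _ _)) ((hLS _ _).add (hSi _ _))]
      congr 1
      refine intervalIntegral.integral_congr fun r _ => ?_
      simp only [lyapunov_sub]
      abel
    have hint : ‖∫ r in (s - x)..s,
        (lyapunov (A r) (C r) (P r - S₀) - x • ((A r)ᵀ * S₀ * A r))‖ ≤ (L * ν + η) * |s - (s - x)| := by
      refine intervalIntegral.norm_integral_le_of_norm_le_const fun r hr => ?_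
      rw [uIoc_of_le hsx] at hr
      have hr1 : ‖P r - P s‖ ≤ η / (2 * (L + 1)) := by
        rw [← dist_eq_norm]
        refine (hcont r ?_).le
        rw [Real.dist_eq, abs_lt]
        constructor <;> linarith [hr.1, hr.2]
      have hr2 : ‖P r - S₀‖ ≤ η / (2 * (L + 1)) + ν := by
        rw [← sub_add_sub_cancel (P r) (P s) S₀]
        exact norm_add_le_of_le hr1 hdist.le
      have h1 : ‖lyapunov (A r) (C r) (P r - S₀)‖ ≤ L * (η / (2 * (L + 1)) + ν) :=
        (norm_lyapunov_le (hAb r) (hCb r)).trans (by gcongr)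
      have h2 : ‖x • ((A r)ᵀ * S₀ * A r)‖ ≤ η / 2 := by
        rw [norm_smul, Real.norm_of_nonneg hx0.le]
        refine le_trans ?_ hxc'
        gcongr
        exact norm_transpose_mul_mul_le (hAb r)
      have h3 : L * (η / (2 * (L + 1))) ≤ η / 2 := by
        rw [mul_div_assoc', div_le_div_iff₀ (by positivity) two_pos]
        nlinarith
      refine (norm_sub_le_of_le h1 h2).trans ?_
      linarith
    rw [sub_sub_cancel, abs_of_pos hx0] at hint
    calc Metric.infDist (P (s - x)) (psdCone n) ≤ ‖P (s - x) - Z‖ := infDist_psdCone_le hZpsd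
      _ ≤ ν + (L * ν + η) * x := by
        rw [hdiff]; exact norm_add_le_of_le hdist.le hint
      _ = ν + x * (L * ν + 0 + η) := by ring
  intro s hs
  have hT : P T = G := by
    rw [heq T ⟨hs.1.trans hs.2, le_rfl⟩, intervalIntegral.integral_same, add_zero]
  have h0 := hcone s hs
  rw [hT, Metric.infDist_zero_of_mem (show G ∈ psdCone n from hG), gronwallBound_ε0_δ0] at h0
  exact posSemidef_of_infDist_nonpos h0

/-! ### Regularizing the coefficients -/

theorem memLInfty_of_norm_le {p q : ℕ} {T K : ℝ} {F : ℝ → Matrix (Fin p) (Fin q) ℝ}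
    (hF : StronglyMeasurable F) (hb : ∀ s ∈ Icc 0 T, ‖F s‖ ≤ K) : MemLInfty T F := by
  intro i j
  have h1 : StronglyMeasurable fun s => F s i j :=
    (show Continuous fun z : Matrix (Fin p) (Fin q) ℝ => z i j by
      fun_prop).comp_stronglyMeasurable hF
  refine memLp_top_of_bound h1.aestronglyMeasurable K ?_
  filter_upwards [ae_restrict_mem measurableSet_Icc] with s hs
  exact (Matrix.norm_entry_le_entrywise_sup_norm (F s)).trans (hb s hs)

theorem MemLInfty.exists_bounded_modification {p q : ℕ} {T : ℝ}
    {M : ℝ → Matrix (Fin p) (Fin q) ℝ} (h : MemLInfty T M) :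
    ∃ (M' : ℝ → Matrix (Fin p) (Fin q) ℝ) (K : ℝ), StronglyMeasurable M' ∧
      (∀ s, ‖M' s‖ ≤ K) ∧ ∀ᵐ s ∂volume.restrict (Icc 0 T), M' s = M s := by
  have hb : ∀ i j, ∃ K : ℝ, ∀ᵐ s ∂volume.restrict (Icc 0 T), ‖M s i j‖ ≤ K := by
    intro i j
    refine ⟨(eLpNormEssSup (fun s => M s i j) (volume.restrict (Icc 0 T))).toReal, ?_⟩
    have hlt : eLpNormEssSup (fun s => M s i j) (volume.restrict (Icc 0 T)) < ⊤ := by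
      rw [← eLpNorm_exponent_top]; exact (h i j).2
    filter_upwards [enorm_ae_le_eLpNormEssSup (fun s => M s i j) (volume.restrict (Icc 0 T))]
      with s hs
    rw [← toReal_enorm]
    exact ENNReal.toReal_mono hlt.ne hs
  choose Kf hKf using hb
  let K : ℝ := ∑ i, ∑ j, |Kf i j|
  have hK0 : 0 ≤ K := Finset.sum_nonneg fun i _ => Finset.sum_nonneg fun j _ => abs_nonneg _
  have hKle : ∀ i j, Kf i j ≤ K := fun i j =>
    (le_abs_self _).trans ((Finset.single_le_sum (f := fun j => |Kf i j|)
      (fun _ _ => abs_nonneg _) (Finset.mem_univ j)).trans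
      (Finset.single_le_sum (f := fun i => ∑ j, |Kf i j|)
        (fun _ _ => Finset.sum_nonneg fun _ _ => abs_nonneg _) (Finset.mem_univ i)))
  let g : ℝ → Matrix (Fin p) (Fin q) ℝ := fun s => Matrix.of fun i j => (h i j).1.mk _ s
  have hg : StronglyMeasurable g := by
    have h1 : Measurable (fun s => (fun i j => (h i j).1.mk _ s : Fin p → Fin q → ℝ)) :=
      measurable_pi_lambda _ fun i => measurable_pi_lambda _ fun j =>
        (h i j).1.stronglyMeasurable_mk.measurable
    exact h1.stronglyMeasurable
  have hgae : ∀ᵐ s ∂volume.restrict (Icc 0 T), ∀ i j, g s i j = M s i j := by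
    rw [ae_all_iff]; intro i
    rw [ae_all_iff]; intro j
    exact (h i j).1.ae_eq_mk.symm
  have hMb : ∀ᵐ s ∂volume.restrict (Icc 0 T), ∀ i j, ‖M s i j‖ ≤ Kf i j := by
    rw [ae_all_iff]; intro i
    rw [ae_all_iff]; intro j
    exact hKf i j
  refine ⟨{s | ‖g s‖ ≤ K}.indicator g, K,
    hg.indicator (measurableSet_le hg.norm.measurable measurable_const), fun s => ?_, ?_⟩
  · by_cases hs : s ∈ {s | ‖g s‖ ≤ K}
    · rw [indicator_of_mem hs]; exact hs
    · rw [indicator_of_notMem hs, norm_zero]; exact hK0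
  · filter_upwards [hgae, hMb] with s h1 h2
    have h3 : g s = M s := Matrix.ext h1
    have h4 : s ∈ {s | ‖g s‖ ≤ K} := by
      change ‖g s‖ ≤ K
      rw [h3]
      exact (Matrix.norm_le_iff hK0).2 fun i j => (h2 i j).trans (hKle i j)
    rw [indicator_of_mem h4, h3]

namespace LQCoeff

variable {n m : ℕ}

/-- The standing assumptions in a form that holds for all real times: the coefficients are
measurable and bounded everywhere, the weights are globally continuous, positive and
nondecreasing in the initial time. -/
structure IsGloballyRegular (c : LQCoeff n m) (δ K : ℝ) : Prop where
  δ_pos : 0 < δ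
  A_meas : StronglyMeasurable c.A
  B_meas : StronglyMeasurable c.B
  C_meas : StronglyMeasurable c.C
  D_meas : StronglyMeasurable c.D
  A_le : ∀ s, ‖c.A s‖ ≤ K
  B_le : ∀ s, ‖c.B s‖ ≤ K
  C_le : ∀ s, ‖c.C s‖ ≤ K
  D_le : ∀ s, ‖c.D s‖ ≤ K
  Q_cont : Continuous fun p : ℝ × ℝ => c.Q p.1 p.2
  R_cont : Continuous fun p : ℝ × ℝ => c.R p.1 p.2
  G_cont : Continuous c.G
  Q_le : ∀ t s, ‖c.Q t s‖ ≤ K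
  R_le : ∀ t s, ‖c.R t s‖ ≤ K
  G_le : ∀ t, ‖c.G t‖ ≤ K
  Q_psd : ∀ t s, (c.Q t s).PosSemidef
  R_coercive : ∀ t s, (c.R t s - δ • (1 : Matrix (Fin m) (Fin m) ℝ)).PosSemidef
  G_psd : ∀ t, (c.G t).PosSemidef
  Q_mono : ∀ t r s, t ≤ r → (c.Q r s - c.Q t s).PosSemidef
  R_mono : ∀ t r s, t ≤ r → (c.R r s - c.R t s).PosSemidef
  G_mono : ∀ t r, t ≤ r → (c.G r - c.G t).PosSemidef

/-- Two sets of data define the same equilibrium Riccati equation on `[0, T]`: the coefficients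
agree almost everywhere, the weights agree on the triangle. -/
structure AgreeOn (c c' : LQCoeff n m) (T : ℝ) : Prop where
  coeff : ∀ᵐ s ∂volume.restrict (Icc 0 T),
    c.A s = c'.A s ∧ c.B s = c'.B s ∧ c.C s = c'.C s ∧ c.D s = c'.D s
  Q_eq : ∀ t s, (t, s) ∈ triangle T → c.Q t s = c'.Q t s
  R_eq : ∀ t s, (t, s) ∈ triangle T → c.R t s = c'.R t s
  G_eq : ∀ t ∈ Icc 0 T, c.G t = c'.G t

theorem AgreeOn.symm {c c' : LQCoeff n m} {T : ℝ} (h : AgreeOn c c' T) : AgreeOn c' c T where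
  coeff := by
    filter_upwards [h.coeff] with s hs
    exact ⟨hs.1.symm, hs.2.1.symm, hs.2.2.1.symm, hs.2.2.2.symm⟩
  Q_eq t s hts := (h.Q_eq t s hts).symm
  R_eq t s hts := (h.R_eq t s hts).symm
  G_eq t ht := (h.G_eq t ht).symm

theorem AgreeOn.theta_ae_eq {c c' : LQCoeff n m} {T : ℝ} (h : AgreeOn c c' T)
    (P : ℝ → ℝ → Matrix (Fin n) (Fin n) ℝ) :
    ∀ᵐ s ∂volume.restrict (Icc 0 T), c.Theta P s = c'.Theta P s := by
  filter_upwards [h.coeff, ae_restrict_mem measurableSet_Icc] with s ⟨hA, hB, hC, hD⟩ hs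
  rw [Theta, Theta, hB, hC, hD, h.R_eq s s ⟨hs.1, le_rfl, hs.2⟩]

theorem AgreeOn.ereField_ae_eq {c c' : LQCoeff n m} {T : ℝ} (h : AgreeOn c c' T)
    (P : ℝ → ℝ → Matrix (Fin n) (Fin n) ℝ) :
    ∀ᵐ s ∂volume, s ∈ Icc 0 T → ∀ t ∈ Icc 0 s, c.ereField P t s = c'.ereField P t s := by
  rw [← ae_restrict_iff' measurableSet_Icc]
  filter_upwards [h.coeff, h.theta_ae_eq P, ae_restrict_mem measurableSet_Icc]
    with s ⟨hA, hB, hC, hD⟩ hΘ hs t ht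
  rw [ereField, ereField, ATheta, ATheta, CTheta, CTheta, hΘ, hA, hB, hC, hD,
    h.Q_eq t s ⟨ht.1, ht.2, hs.2⟩, h.R_eq t s ⟨ht.1, ht.2, hs.2⟩]

theorem AgreeOn.isERESolution {c c' : LQCoeff n m} {T : ℝ} (h : AgreeOn c c' T)
    {P : ℝ → ℝ → Matrix (Fin n) (Fin n) ℝ} (hP : c.IsERESolution T P) : c'.IsERESolution T P where
  cont := hP.cont
  posSemidef := hP.posSemidef
  integrable t ht i j := by
    refine (hP.integrable t ht i j).congr_ae ?_
    rw [uIoc_of_le ht.2, EventuallyEq, ae_restrict_iff' measurableSet_Ioc]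
    filter_upwards [h.ereField_ae_eq P] with r hr hr2
    rw [hr ⟨ht.1.trans hr2.1.le, hr2.2⟩ t ⟨ht.1, hr2.1.le⟩]
  eq t s hts i j := by
    rw [hP.eq t s hts i j, h.G_eq t ⟨hts.1, hts.2.1.trans hts.2.2⟩]
    congr 1
    refine intervalIntegral.integral_congr_ae ?_
    rw [uIoc_of_le hts.2.2]
    filter_upwards [h.ereField_ae_eq P] with r hr hr2
    have htr : t ≤ r := hts.2.1.trans hr2.1.le
    rw [hr ⟨hts.1.trans htr, hr2.2⟩ t ⟨hts.1, htr⟩]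

theorem exists_isGloballyRegular {c : LQCoeff n m} {T : ℝ} (hT : 0 ≤ T) (hreg : c.IsRegular T)
    (hpos : c.IsPositive T) (hmono : c.IsMonotone T) :
    ∃ (c' : LQCoeff n m) (δ K : ℝ), c'.IsGloballyRegular δ K ∧ AgreeOn c c' T := by
  obtain ⟨A, KA, hAm, hAb, hA⟩ := hreg.A_mem.exists_bounded_modification
  obtain ⟨B, KB, hBm, hBb, hB⟩ := hreg.B_mem.exists_bounded_modification
  obtain ⟨C, KC, hCm, hCb, hC⟩ := hreg.C_mem.exists_bounded_modification
  obtain ⟨D, KD, hDm, hDb, hD⟩ := hreg.D_mem.exists_bounded_modification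
  obtain ⟨δ, hδ, hp⟩ := hpos
  obtain ⟨_, _, _, _, _, _, hm⟩ := hmono
  have hsq : IsCompact (Icc 0 T ×ˢ Icc 0 T) := isCompact_Icc.prod isCompact_Icc
  obtain ⟨KQ, hKQ⟩ := hsq.exists_bound_of_continuousOn hreg.Q_cont
  obtain ⟨KR, hKR⟩ := hsq.exists_bound_of_continuousOn hreg.R_cont
  obtain ⟨KG, hKG⟩ := isCompact_Icc.exists_bound_of_continuousOn hreg.G_cont
  have hcl : Continuous (clamp T) := continuous_clamp T
  have hmem : ∀ s, clamp T s ∈ Icc 0 T := clamp_mem hT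
  have hle : ∀ t s, clamp T (min t s) ≤ clamp T s := fun t s => clamp_mono (min_le_right t s)
  have hpair : Continuous fun p : ℝ × ℝ => (clamp T (min p.1 p.2), clamp T p.2) :=
    (hcl.comp (continuous_fst.min continuous_snd)).prodMk (hcl.comp continuous_snd)
  let K := max (max (max KA KB) (max KC KD)) (max (max KQ KR) KG)
  have hmn : ∀ t r s : ℝ, t ≤ r → clamp T (min t s) ≤ clamp T (min r s) := fun t r s h =>
    clamp_mono (min_le_min h le_rfl)
  refine ⟨⟨A, B, C, D, fun t s => c.Q (clamp T (min t s)) (clamp T s),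
    fun t s => c.R (clamp T (min t s)) (clamp T s), fun t => c.G (clamp T t)⟩, δ, K, ?_, ?_⟩
  · refine ⟨hδ, hAm, hBm, hCm, hDm, fun s => (hAb s).trans ?_, fun s => (hBb s).trans ?_,
      fun s => (hCb s).trans ?_, fun s => (hDb s).trans ?_,
      hreg.Q_cont.comp_continuous hpair fun p => ⟨hmem _, hmem _⟩,
      hreg.R_cont.comp_continuous hpair fun p => ⟨hmem _, hmem _⟩,
      hreg.G_cont.comp_continuous hcl hmem,
      fun t s => (hKQ (_, _) ⟨hmem (min t s), hmem s⟩).trans ?_,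
      fun t s => (hKR (_, _) ⟨hmem (min t s), hmem s⟩).trans ?_,
      fun t => (hKG _ (hmem t)).trans ?_,
      fun t s => (hp _ _ (hmem _).1 (hle t s) (hmem _).2).1,
      fun t s => (hp _ _ (hmem _).1 (hle t s) (hmem _).2).2.1,
      fun t => (hp _ _ (hmem t).1 le_rfl (hmem t).2).2.2,
      fun t r s h => (hm _ _ _ (hmem _).1 (hmn t r s h) (hle r s) (hmem _).2).1.1,
      fun t r s h => (hm _ _ _ (hmem _).1 (hmn t r s h) (hle r s) (hmem _).2).2.1.1,
      fun t r h => (hm _ _ _ (hmem t).1 (clamp_mono h) le_rfl (hmem r).2).2.2.1⟩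
    all_goals simp [K]
  · have hcl2 : ∀ t s, (t, s) ∈ triangle T → clamp T (min t s) = t ∧ clamp T s = s := by
      intro t s h
      rw [min_eq_left h.2.1]
      exact ⟨clamp_of_mem ⟨h.1, h.2.1.trans h.2.2⟩, clamp_of_mem ⟨h.1.trans h.2.1, h.2.2⟩⟩
    refine ⟨?_, fun t s h => ?_, fun t s h => ?_, fun t h => ?_⟩
    · filter_upwards [hA, hB, hC, hD] with s h1 h2 h3 h4
      exact ⟨h1.symm, h2.symm, h3.symm, h4.symm⟩
    · simp only [(hcl2 t s h).1, (hcl2 t s h).2]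
    · simp only [(hcl2 t s h).1, (hcl2 t s h).2]
    · simp only [clamp_of_mem h]

/-! ### The truncated feedback -/

/-- The feedback `-[R(s,s) + D(s)ᵀ p D(s)]⁻¹ [B(s)ᵀ p + D(s)ᵀ p C(s)]` as a function of the matrix
`p` that stands for the diagonal value `P(s,s)`. -/
noncomputable def feedback (c : LQCoeff n m) (s : ℝ) (p : Matrix (Fin n) (Fin n) ℝ) :
    Matrix (Fin m) (Fin n) ℝ :=
  -((c.R s s + (c.D s)ᵀ * p * c.D s)⁻¹ * ((c.B s)ᵀ * p + (c.D s)ᵀ * p * c.C s))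

/-- The right-hand side of the Riccati equation as a function of the value `x = P(t,s)` and of a
feedback matrix `θ`. -/
def riccatiField (c : LQCoeff n m) (t s : ℝ) (x : Matrix (Fin n) (Fin n) ℝ)
    (θ : Matrix (Fin m) (Fin n) ℝ) : Matrix (Fin n) (Fin n) ℝ :=
  lyapunov (c.A s + c.B s * θ) (c.C s + c.D s * θ) x + c.Q t s + θᵀ * c.R t s * θ

theorem ereField_eq (c : LQCoeff n m) (P : ℝ → ℝ → Matrix (Fin n) (Fin n) ℝ) (t s : ℝ) :
    c.ereField P t s = c.riccatiField t s (P t s) (c.feedback s (P s s)) := rfl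

namespace IsGloballyRegular

variable {c : LQCoeff n m} {δ K : ℝ} (hc : c.IsGloballyRegular δ K)
include hc

theorem R_psd (t s : ℝ) : (c.R t s).PosSemidef := by
  have h1 : (δ • (1 : Matrix (Fin m) (Fin m) ℝ)).PosSemidef :=
    Matrix.PosSemidef.one.smul hc.δ_pos.le
  have := (hc.R_coercive t s).add h1
  rwa [sub_add_cancel] at this

theorem coercive_bracket (s : ℝ) {p : Matrix (Fin n) (Fin n) ℝ} (hp : p.PosSemidef) :
    (c.R s s + (c.D s)ᵀ * p * c.D s - δ • (1 : Matrix (Fin m) (Fin m) ℝ)).PosSemidef := by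
  rw [add_sub_right_comm]
  exact (hc.R_coercive s s).add (hp.transpose_mul_mul _)

theorem stronglyMeasurable_feedback {p : ℝ → Matrix (Fin n) (Fin n) ℝ}
    (hp : StronglyMeasurable p) : StronglyMeasurable fun s => c.feedback s (p s) := by
  have hR : StronglyMeasurable fun s => c.R s s :=
    (hc.R_cont.comp (continuous_id.prodMk continuous_id)).stronglyMeasurable
  have hDp := stronglyMeasurable_matrix_mul (stronglyMeasurable_matrix_transpose hc.D_meas) hp
  exact (stronglyMeasurable_matrix_mul
    (stronglyMeasurable_matrix_inv (hR.add (stronglyMeasurable_matrix_mul hDp hc.D_meas)))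
    ((stronglyMeasurable_matrix_mul (stronglyMeasurable_matrix_transpose hc.B_meas) hp).add
      (stronglyMeasurable_matrix_mul hDp hc.C_meas))).neg

theorem stronglyMeasurable_closedLoop {Θ : ℝ → Matrix (Fin m) (Fin n) ℝ}
    (hΘ : StronglyMeasurable Θ) :
    StronglyMeasurable (fun s => c.A s + c.B s * Θ s) ∧
      StronglyMeasurable (fun s => c.C s + c.D s * Θ s) :=
  ⟨hc.A_meas.add (stronglyMeasurable_matrix_mul hc.B_meas hΘ),
    hc.C_meas.add (stronglyMeasurable_matrix_mul hc.D_meas hΘ)⟩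

theorem stronglyMeasurable_source {Θ : ℝ → Matrix (Fin m) (Fin n) ℝ}
    (hΘ : StronglyMeasurable Θ) (t : ℝ) :
    StronglyMeasurable fun s => c.Q t s + (Θ s)ᵀ * c.R t s * Θ s := by
  have hQ : StronglyMeasurable fun s => c.Q t s :=
    (hc.Q_cont.comp (continuous_const.prodMk continuous_id)).stronglyMeasurable
  have hR : StronglyMeasurable fun s => c.R t s :=
    (hc.R_cont.comp (continuous_const.prodMk continuous_id)).stronglyMeasurable
  exact hQ.add (stronglyMeasurable_matrix_mul
    (stronglyMeasurable_matrix_mul (stronglyMeasurable_matrix_transpose hΘ) hR) hΘ)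

theorem stronglyMeasurable_riccatiField {Θ : ℝ → Matrix (Fin m) (Fin n) ℝ}
    (hΘ : StronglyMeasurable Θ) {x : ℝ → Matrix (Fin n) (Fin n) ℝ} (hx : StronglyMeasurable x)
    (t : ℝ) : StronglyMeasurable fun s => c.riccatiField t s (x s) (Θ s) := by
  obtain ⟨h1, h2⟩ := hc.stronglyMeasurable_closedLoop hΘ
  have := (stronglyMeasurable_lyapunov h1 h2 hx).add (hc.stronglyMeasurable_source hΘ t)
  simpa only [riccatiField, Pi.add_def, add_assoc] using this

theorem uniformlyBddLip_feedback {M : ℝ} (hM : 0 < M) :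
    UniformlyBddLip fun (i : ℝ × ℝ)
      (z : Matrix (Fin n) (Fin n) ℝ × Matrix (Fin n) (Fin n) ℝ) =>
        c.feedback i.2 (psdCut M z.2) := by
  have hp : UniformlyBddLip fun (_ : ℝ × ℝ)
      (z : Matrix (Fin n) (Fin n) ℝ × Matrix (Fin n) (Fin n) ℝ) => psdCut M z.2 := by
    refine ⟨max M (2 * (1 + n)), by positivity,
      fun i z => (norm_radialCut_le hM _).trans (le_max_left _ _), fun i z w => ?_⟩
    refine (norm_psdCut_sub_le hM _ _).trans ?_
    gcongr
    · exact le_max_right _ _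
    · rw [← dist_eq_norm]; exact le_max_right _ _
  have hB := UniformlyBddLip.const
    (X := Matrix (Fin n) (Fin n) ℝ × Matrix (Fin n) (Fin n) ℝ) fun i : ℝ × ℝ => hc.B_le i.2
  have hC := UniformlyBddLip.const
    (X := Matrix (Fin n) (Fin n) ℝ × Matrix (Fin n) (Fin n) ℝ) fun i : ℝ × ℝ => hc.C_le i.2
  have hD := UniformlyBddLip.const
    (X := Matrix (Fin n) (Fin n) ℝ × Matrix (Fin n) (Fin n) ℝ) fun i : ℝ × ℝ => hc.D_le i.2
  have hR := UniformlyBddLip.const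
    (X := Matrix (Fin n) (Fin n) ℝ × Matrix (Fin n) (Fin n) ℝ) fun i : ℝ × ℝ => hc.R_le i.2 i.2
  have hDp := hD.transpose.mul hp
  exact (((hR.add (hDp.mul hD)).inv hc.δ_pos fun i z =>
    hc.coercive_bracket i.2 (posSemidef_psdCut hM z.2)).mul
      ((hB.transpose.mul hp).add (hDp.mul hC))).neg

/-- The closed-loop coefficients and the source term under a truncated feedback are uniformly
bounded and Lipschitz. -/
theorem uniformlyBddLip_closedLoop {M : ℝ} (hM : 0 < M) :
    (UniformlyBddLip fun (i : ℝ × ℝ)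
      (z : Matrix (Fin n) (Fin n) ℝ × Matrix (Fin n) (Fin n) ℝ) =>
        c.A i.2 + c.B i.2 * c.feedback i.2 (psdCut M z.2)) ∧
    (UniformlyBddLip fun (i : ℝ × ℝ)
      (z : Matrix (Fin n) (Fin n) ℝ × Matrix (Fin n) (Fin n) ℝ) =>
        c.C i.2 + c.D i.2 * c.feedback i.2 (psdCut M z.2)) ∧
    (UniformlyBddLip fun (i : ℝ × ℝ)
      (z : Matrix (Fin n) (Fin n) ℝ × Matrix (Fin n) (Fin n) ℝ) =>
        c.Q i.1 i.2 + (c.feedback i.2 (psdCut M z.2))ᵀ * c.R i.1 i.2 *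
          c.feedback i.2 (psdCut M z.2)) := by
  have hΘ := hc.uniformlyBddLip_feedback hM
  have hA := UniformlyBddLip.const
    (X := Matrix (Fin n) (Fin n) ℝ × Matrix (Fin n) (Fin n) ℝ) fun i : ℝ × ℝ => hc.A_le i.2
  have hB := UniformlyBddLip.const
    (X := Matrix (Fin n) (Fin n) ℝ × Matrix (Fin n) (Fin n) ℝ) fun i : ℝ × ℝ => hc.B_le i.2
  have hC := UniformlyBddLip.const
    (X := Matrix (Fin n) (Fin n) ℝ × Matrix (Fin n) (Fin n) ℝ) fun i : ℝ × ℝ => hc.C_le i.2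
  have hD := UniformlyBddLip.const
    (X := Matrix (Fin n) (Fin n) ℝ × Matrix (Fin n) (Fin n) ℝ) fun i : ℝ × ℝ => hc.D_le i.2
  have hQ := UniformlyBddLip.const
    (X := Matrix (Fin n) (Fin n) ℝ × Matrix (Fin n) (Fin n) ℝ) fun i : ℝ × ℝ => hc.Q_le i.1 i.2
  have hR := UniformlyBddLip.const
    (X := Matrix (Fin n) (Fin n) ℝ × Matrix (Fin n) (Fin n) ℝ) fun i : ℝ × ℝ => hc.R_le i.1 i.2
  exact ⟨hA.add (hB.mul hΘ), hC.add (hD.mul hΘ), hQ.add ((hΘ.transpose.mul hR).mul hΘ)⟩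

theorem uniformlyBddLip_riccatiField {M N : ℝ} (hM : 0 < M) (hN : 0 < N) :
    UniformlyBddLip fun (i : ℝ × ℝ)
      (z : Matrix (Fin n) (Fin n) ℝ × Matrix (Fin n) (Fin n) ℝ) =>
        c.riccatiField i.1 i.2 (radialCut N z.1) (c.feedback i.2 (psdCut M z.2)) := by
  have hx : UniformlyBddLip fun (_ : ℝ × ℝ)
      (z : Matrix (Fin n) (Fin n) ℝ × Matrix (Fin n) (Fin n) ℝ) => radialCut N z.1 := by
    refine ⟨max N 2, by positivity,
      fun i z => (norm_radialCut_le hN _).trans (le_max_left _ _), fun i z w => ?_⟩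
    refine (norm_radialCut_sub_le hN _ _).trans ?_
    gcongr
    · exact le_max_right _ _
    · rw [← dist_eq_norm]; exact le_max_left _ _
  obtain ⟨hA, hC, hS⟩ := hc.uniformlyBddLip_closedLoop hM
  have := (((hx.mul hA).add (hA.transpose.mul hx)).add ((hC.transpose.mul hx).mul hC)).add hS
  simpa only [riccatiField, lyapunov, add_assoc] using this

end IsGloballyRegular

/-! ### Optimality of the feedback -/

/-- For `λ ∈ (0, 1]` the feedback computed from `λ y` is optimal for the value `y` and the larger
control weight `λ⁻¹ R`, so it does not increase the trace of the right-hand side compared with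
zero control. -/
theorem trace_riccatiField_feedback_le {c : LQCoeff n m} {δ K : ℝ} (hc : c.IsGloballyRegular δ K)
    (r : ℝ) {y : Matrix (Fin n) (Fin n) ℝ} (hy : y.PosSemidef) {l : ℝ} (hl : 0 < l)
    (hl1 : l ≤ 1) :
    (c.riccatiField r r y (c.feedback r (l • y))).trace ≤
      (lyapunov (c.A r) (c.C r) y + c.Q r r).trace := by
  have hly : (l • y).PosSemidef := hy.smul hl.le
  set θ := c.feedback r (l • y) with hθ
  set X := c.R r r + (c.D r)ᵀ * (l • y) * c.D r with hX
  set N := (c.B r)ᵀ * (l • y) + (c.D r)ᵀ * (l • y) * c.C r with hN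
  have hco := hc.coercive_bracket r hly
  have hXpsd : X.PosSemidef := (hc.R_psd r r).add (hly.transpose_mul_mul _)
  have hXu : IsUnit X.det := (Matrix.isUnit_iff_isUnit_det _).1 (isUnit_of_coercive hc.δ_pos hco)
  have hNθ : N = -(X * θ) := by
    change N = -(X * -(X⁻¹ * N))
    rw [Matrix.mul_neg, neg_neg, ← Matrix.mul_assoc, Matrix.mul_nonsing_inv _ hXu, Matrix.one_mul]
  have hys : yᵀ = y := hy.isSymm_real
  -- the control-dependent part of the field, without the weight `θᵀ R θ`
  set U := y * (c.B r * θ) + (c.B r * θ)ᵀ * y + (c.C r)ᵀ * y * (c.D r * θ) +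
    (c.D r * θ)ᵀ * y * c.C r + (c.D r * θ)ᵀ * y * (c.D r * θ) with hU
  have h1 : c.riccatiField r r y θ =
      lyapunov (c.A r) (c.C r) y + c.Q r r + (U + θᵀ * c.R r r * θ) := by
    simp only [riccatiField, lyapunov, hU, Matrix.transpose_add, Matrix.add_mul, Matrix.mul_add]
    abel
  have h2 : l • U = Nᵀ * θ + θᵀ * N + θᵀ * (X - c.R r r) * θ := by
    simp only [hU, hN, hX, add_sub_cancel_left, Matrix.transpose_add, Matrix.transpose_mul,
      Matrix.transpose_smul, Matrix.transpose_transpose, hys, Matrix.add_mul, Matrix.mul_add,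
      Matrix.smul_mul, Matrix.mul_smul, smul_add, Matrix.mul_assoc]
    abel
  have h3 : l • U = -(θᵀ * X * θ) - θᵀ * c.R r r * θ := by
    rw [h2, hNθ, Matrix.transpose_neg, Matrix.transpose_mul, hXpsd.isSymm_real.eq]
    simp only [Matrix.neg_mul, Matrix.mul_neg, Matrix.mul_sub, Matrix.sub_mul, Matrix.mul_assoc]
    abel
  have h4 := congrArg Matrix.trace h3
  rw [Matrix.trace_smul, Matrix.trace_sub, Matrix.trace_neg, smul_eq_mul] at h4
  have h5 := (hXpsd.transpose_mul_mul θ).trace_nonneg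
  have h6 := ((hc.R_psd r r).transpose_mul_mul θ).trace_nonneg
  have h7 : U.trace + (θᵀ * c.R r r * θ).trace ≤ 0 := by
    by_contra! hcon
    nlinarith
  rw [h1, Matrix.trace_add _ (U + _), Matrix.trace_add U]
  linarith

/-! ### Solutions driven by a given feedback -/

/-- `P` solves, for every initial time, the linear equation with terminal value `G(t)` and the
closed-loop coefficients of the prescribed feedback `Θ`. -/
structure IsLinearSolution (c : LQCoeff n m) (T : ℝ) (Θ : ℝ → Matrix (Fin m) (Fin n) ℝ)
    (P : ℝ → ℝ → Matrix (Fin n) (Fin n) ℝ) : Prop where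
  meas : StronglyMeasurable Θ
  bdd : ∃ K, ∀ s, ‖Θ s‖ ≤ K
  cont : Continuous fun p : ℝ × ℝ => P p.1 p.2
  eq : ∀ t, ∀ s ∈ Icc 0 T, P t s = c.G t + ∫ r in s..T, c.riccatiField t r (P t r) (Θ r)

namespace IsLinearSolution

variable {c : LQCoeff n m} {δ K T : ℝ} {Θ : ℝ → Matrix (Fin m) (Fin n) ℝ}
  {P : ℝ → ℝ → Matrix (Fin n) (Fin n) ℝ}

theorem cont_right (h : c.IsLinearSolution T Θ P) (t : ℝ) : Continuous (P t) :=
  h.cont.comp (continuous_const.prodMk continuous_id)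

theorem exists_closedLoop_bound (hc : c.IsGloballyRegular δ K) (h : c.IsLinearSolution T Θ P) :
    ∃ K', (∀ s, ‖c.A s + c.B s * Θ s‖ ≤ K') ∧ (∀ s, ‖c.C s + c.D s * Θ s‖ ≤ K') ∧
      ∀ t s, ‖c.Q t s + (Θ s)ᵀ * c.R t s * Θ s‖ ≤ K' := by
  obtain ⟨L, hL⟩ := h.bdd
  have hΘ := UniformlyBddLip.const (X := ℝ) fun i : ℝ × ℝ => hL i.2
  have hA := UniformlyBddLip.const (X := ℝ) fun i : ℝ × ℝ => hc.A_le i.2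
  have hB := UniformlyBddLip.const (X := ℝ) fun i : ℝ × ℝ => hc.B_le i.2
  have hC := UniformlyBddLip.const (X := ℝ) fun i : ℝ × ℝ => hc.C_le i.2
  have hD := UniformlyBddLip.const (X := ℝ) fun i : ℝ × ℝ => hc.D_le i.2
  have hQ := UniformlyBddLip.const (X := ℝ) fun i : ℝ × ℝ => hc.Q_le i.1 i.2
  have hR := UniformlyBddLip.const (X := ℝ) fun i : ℝ × ℝ => hc.R_le i.1 i.2
  obtain ⟨K₁, -, h1, -⟩ := hA.add (hB.mul hΘ)
  obtain ⟨K₂, -, h2, -⟩ := hC.add (hD.mul hΘ)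
  obtain ⟨K₃, -, h3, -⟩ := hQ.add ((hΘ.transpose.mul hR).mul hΘ)
  refine ⟨max K₁ (max K₂ K₃), fun s => (h1 (0, s) 0).trans ?_, fun s => (h2 (0, s) 0).trans ?_,
    fun t s => (h3 (t, s) 0).trans ?_⟩ <;> simp

theorem intervalIntegrable_source (hc : c.IsGloballyRegular δ K) (h : c.IsLinearSolution T Θ P)
    (t u v : ℝ) :
    IntervalIntegrable (fun s => c.Q t s + (Θ s)ᵀ * c.R t s * Θ s) volume u v := by
  obtain ⟨K', -, -, h3⟩ := h.exists_closedLoop_bound hc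
  exact intervalIntegrable_of_norm_le (hc.stronglyMeasurable_source h.meas t) (h3 t) u v

theorem intervalIntegrable_riccatiField (hc : c.IsGloballyRegular δ K)
    (h : c.IsLinearSolution T Θ P) (t u v : ℝ) :
    IntervalIntegrable (fun s => c.riccatiField t s (P t s) (Θ s)) volume u v := by
  obtain ⟨K', h1, h2, h3⟩ := h.exists_closedLoop_bound hc
  obtain ⟨N, hN⟩ := (isCompact_uIcc (a := u) (b := v)).exists_bound_of_continuousOn
    (h.cont_right t).continuousOn
  have hK' : 0 ≤ K' := (norm_nonneg _).trans (h1 0)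
  refine (intervalIntegrable_const (c := (2 * n * K' + n * n * K' * K') * N + K')).mono_fun'
    (hc.stronglyMeasurable_riccatiField h.meas
      (h.cont_right t).stronglyMeasurable t).aestronglyMeasurable ?_
  refine (ae_restrict_iff' measurableSet_uIoc).2 (.of_forall fun r hr => ?_)
  have h4 : ‖lyapunov (c.A r + c.B r * Θ r) (c.C r + c.D r * Θ r) (P t r)‖ ≤
      (2 * n * K' + n * n * K' * K') * N :=
    (norm_lyapunov_le (h1 r) (h2 r)).trans
      (mul_le_mul_of_nonneg_left (hN r (uIoc_subset_uIcc hr)) (by positivity))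
  have := norm_add_le_of_le h4 (h3 t r)
  simpa only [riccatiField, add_assoc] using this

theorem posSemidef (hc : c.IsGloballyRegular δ K) (h : c.IsLinearSolution T Θ P) (t : ℝ) :
    ∀ s ∈ Icc 0 T, (P t s).PosSemidef := by
  obtain ⟨K', h1, h2, -⟩ := h.exists_closedLoop_bound hc
  obtain ⟨m1, m2⟩ := hc.stronglyMeasurable_closedLoop h.meas
  refine posSemidef_of_lyapunov_eq m1 m2 h1 h2 (h.cont_right t)
    (h.intervalIntegrable_source hc t)
    (fun r => (hc.Q_psd t r).add ((hc.R_psd t r).transpose_mul_mul _)) (hc.G_psd t)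
    fun s hs => ?_
  simpa only [riccatiField, add_assoc] using h.eq t s hs

/-- Monotonicity in the initial time: `P(t', ·) - P(t, ·)` solves a Lyapunov equation with positive
semidefinite data. -/
theorem mono (hc : c.IsGloballyRegular δ K) (h : c.IsLinearSolution T Θ P) {t t' : ℝ}
    (htt : t ≤ t') : ∀ s ∈ Icc 0 T, (P t' s - P t s).PosSemidef := by
  obtain ⟨K', h1, h2, -⟩ := h.exists_closedLoop_bound hc
  obtain ⟨m1, m2⟩ := hc.stronglyMeasurable_closedLoop h.meas
  refine posSemidef_of_lyapunov_eq (P := fun s => P t' s - P t s) m1 m2 h1 h2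
    ((h.cont_right t').sub (h.cont_right t))
    (fun u v => (h.intervalIntegrable_source hc t' u v).sub (h.intervalIntegrable_source hc t u v))
    (fun r => ?_) (hc.G_mono t t' htt) fun s hs => ?_
  · have := (hc.Q_mono t t' r htt).add ((hc.R_mono t t' r htt).transpose_mul_mul (Θ r))
    rwa [Matrix.mul_sub, Matrix.sub_mul, sub_add_sub_comm] at this
  · rw [h.eq t' s hs, h.eq t s hs, add_sub_add_comm,
      ← intervalIntegral.integral_sub (h.intervalIntegrable_riccatiField hc t' _ _)
        (h.intervalIntegrable_riccatiField hc t _ _)]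
    congr 1
    refine intervalIntegral.integral_congr fun r _ => ?_
    simp only [riccatiField, lyapunov_sub]
    abel

theorem step (hc : c.IsGloballyRegular δ K) (h : c.IsLinearSolution T Θ P) (t : ℝ) {u v : ℝ}
    (hu : 0 ≤ u) (huv : u ≤ v) (hv : v ≤ T) :
    P t u = P t v + ∫ r in u..v, c.riccatiField t r (P t r) (Θ r) := by
  rw [h.eq t u ⟨hu, huv.trans hv⟩, h.eq t v ⟨hu.trans huv, hv⟩, add_assoc,
    add_comm (∫ r in v..T, _), intervalIntegral.integral_add_adjacent_intervals
      (h.intervalIntegrable_riccatiField hc t _ _) (h.intervalIntegrable_riccatiField hc t _ _)]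

end IsLinearSolution

/-- Gronwall bound for the diagonal values of a solution whose feedback is computed from the
diagonal by a truncation. The bound does not depend on the level of truncation. -/
theorem IsLinearSolution.trace_diag_le {c : LQCoeff n m} {δ K T M : ℝ}
    (hc : c.IsGloballyRegular δ K) (hM : 0 < M) {P : ℝ → ℝ → Matrix (Fin n) (Fin n) ℝ}
    (h : c.IsLinearSolution T (fun s => c.feedback s (psdCut M (P s s))) P) :
    ∀ s ∈ Icc 0 T, (P s s).trace ≤
      gronwallBound (c.G T).trace (n * (2 * n * K + n * n * K * K)) (n * K) (T - s) := by
  intro s₀ hs₀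
  set Θ := fun s => c.feedback s (psdCut M (P s s)) with hΘ
  have hK : 0 ≤ K := (norm_nonneg _).trans (hc.A_le 0)
  obtain ⟨K', h1, h2, -⟩ := h.exists_closedLoop_bound hc
  have hK' : 0 ≤ K' := (norm_nonneg _).trans (h1 0)
  set L₀ : ℝ := 2 * n * K + n * n * K * K with hL₀
  set L : ℝ := 2 * n * K' + n * n * K' * K' with hL
  have hL₀0 : 0 ≤ L₀ := by positivity
  have hL0 : 0 ≤ L := by positivity
  have hdiag : Continuous fun s => P s s := h.cont.comp (continuous_id.prodMk continuous_id)
  have hT : (P T T).trace = (c.G T).trace := by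
    rw [h.eq T T ⟨hs₀.1.trans hs₀.2, le_rfl⟩, intervalIntegral.integral_same, add_zero]
  rw [← hT]
  refine le_gronwallBound_of_backward_slope (f := fun s => (P s s).trace)
    hdiag.matrix_trace.continuousOn (fun s hs η hη => ?_) s₀ hs₀
  have hε : 0 < η / (n * (2 * L + L₀) + 1) := by positivity
  set ε := η / (n * (2 * L + L₀) + 1) with hε_def
  have hεη : n * (2 * L + L₀) * ε ≤ η := by
    have : (n * (2 * L + L₀) + 1) * ε = η := by rw [hε_def]; field
    nlinarith
  obtain ⟨ρ, hρ, hcont⟩ := Metric.continuous_iff.1 h.cont (s, s) _ hε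
  have hnear : ∀ u v, |u - s| < ρ → |v - s| < ρ → ‖P u v - P s s‖ ≤ ε := by
    intro u v hu hv
    rw [← dist_eq_norm]
    refine (hcont (u, v) ?_).le
    rw [Prod.dist_eq, Real.dist_eq, Real.dist_eq]
    exact max_lt hu hv
  filter_upwards [Ioo_mem_nhdsGT (lt_min hρ hs.1)] with x hx
  have hx0 : 0 < x := hx.1
  have hxρ : x < ρ := hx.2.trans_le (min_le_left _ _)
  have hxs : x < s := hx.2.trans_le (min_le_right _ _)
  have hsx : s - x ≤ s := by linarith
  have hsIcc : s ∈ Icc 0 T := ⟨hs.1.le, hs.2⟩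
  have hpt : ∀ r ∈ Icc (s - x) s, (c.riccatiField (s - x) r (P (s - x) r) (Θ r)).trace ≤
      n * L₀ * (P s s).trace + n * K + η := by
    intro r hr
    have hrI : r ∈ Icc 0 T := ⟨by linarith [hr.1], hr.2.trans hs.2⟩
    have hrr : (P r r).PosSemidef := h.posSemidef hc r r hrI
    have hrρ : |r - s| < ρ := by rw [abs_lt]; constructor <;> linarith [hr.1, hr.2]
    have hxρ' : |s - x - s| < ρ := by rw [abs_lt]; constructor <;> linarith
    -- raise the initial time of the weights from `s - x` to `r`
    have e1 : (c.riccatiField (s - x) r (P (s - x) r) (Θ r)).trace ≤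
        (c.riccatiField r r (P (s - x) r) (Θ r)).trace := by
      refine trace_mono ?_
      have := (hc.Q_mono (s - x) r r hr.1).add
        ((hc.R_mono (s - x) r r hr.1).transpose_mul_mul (Θ r))
      convert this using 1
      simp only [riccatiField, Matrix.mul_sub, Matrix.sub_mul]
      abel
    have e2 : (c.riccatiField r r (P (s - x) r) (Θ r)).trace ≤
        (c.riccatiField r r (P r r) (Θ r)).trace + n * (L * (2 * ε)) := by
      have d1 : c.riccatiField r r (P (s - x) r) (Θ r) - c.riccatiField r r (P r r) (Θ r) =
          lyapunov (c.A r + c.B r * Θ r) (c.C r + c.D r * Θ r) (P (s - x) r - P r r) := by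
        simp only [riccatiField, lyapunov_sub]
        abel
      have d2 : ‖P (s - x) r - P r r‖ ≤ 2 * ε := by
        rw [← sub_sub_sub_cancel_right (P (s - x) r) (P r r) (P s s), two_mul]
        exact norm_sub_le_of_le (hnear _ _ hxρ' hrρ) (hnear _ _ hrρ hrρ)
      have d3 := (le_abs_self _).trans (abs_trace_le
        (c.riccatiField r r (P (s - x) r) (Θ r) - c.riccatiField r r (P r r) (Θ r)))
      have d4 : (n : ℝ) * ‖lyapunov (c.A r + c.B r * Θ r) (c.C r + c.D r * Θ r)
          (P (s - x) r - P r r)‖ ≤ n * (L * (2 * ε)) :=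
        mul_le_mul_of_nonneg_left ((norm_lyapunov_le (h1 r) (h2 r)).trans
          (mul_le_mul_of_nonneg_left d2 hL0)) (Nat.cast_nonneg _)
      rw [Matrix.trace_sub, d1] at d3
      linarith
    have e3 : (c.riccatiField r r (P r r) (Θ r)).trace ≤
        (lyapunov (c.A r) (c.C r) (P r r) + c.Q r r).trace := by
      obtain ⟨l, hl, hl1, he⟩ := exists_psdCut_eq_smul hM hrr
      simp only [hΘ, he]
      exact trace_riccatiField_feedback_le hc r hrr hl hl1
    have e4 : (lyapunov (c.A r) (c.C r) (P r r) + c.Q r r).trace ≤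
        n * (L₀ * ((P s s).trace + ε) + K) := by
      refine (le_abs_self _).trans ((abs_trace_le _).trans ?_)
      refine mul_le_mul_of_nonneg_left (norm_add_le_of_le ?_ (hc.Q_le r r)) (Nat.cast_nonneg _)
      refine (norm_lyapunov_le (hc.A_le r) (hc.C_le r)).trans
        (mul_le_mul_of_nonneg_left ?_ hL₀0)
      rw [← add_sub_cancel (P s s) (P r r)]
      exact norm_add_le_of_le (h.posSemidef hc s s hsIcc).norm_le_trace (hnear _ _ hrρ hrρ)
    nlinarith
  have hint := h.intervalIntegrable_riccatiField hc (s - x) (s - x) s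
  have hI : (∫ r in (s - x)..s, c.riccatiField (s - x) r (P (s - x) r) (Θ r)).trace ≤
      x * (n * L₀ * (P s s).trace + n * K + η) := by
    rw [integral_trace hint]
    refine (intervalIntegral.integral_mono_on hsx (intervalIntegrable_trace hint)
      intervalIntegrable_const hpt).trans (le_of_eq ?_)
    rw [intervalIntegral.integral_const, sub_sub_cancel, smul_eq_mul]
  have hm := trace_mono (h.mono hc hsx s hsIcc)
  change (P (s - x) (s - x)).trace ≤ _
  rw [h.step hc (s - x) (by linarith) hsx hs.2, Matrix.trace_add]
  linarith

/-! ### Solving the truncated equation -/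

theorem IsGloballyRegular.continuous_feedback {c : LQCoeff n m} {δ K M : ℝ}
    (hc : c.IsGloballyRegular δ K) (hM : 0 < M) (r : ℝ) :
    Continuous fun y : Matrix (Fin n) (Fin n) ℝ => c.feedback r (psdCut M y) := by
  obtain ⟨KΘ, -, -, hΘl⟩ := hc.uniformlyBddLip_feedback hM
  refine (LipschitzWith.of_dist_le' (K := KΘ) fun x y => ?_).continuous
  rw [dist_eq_norm]
  refine (hΘl (0, r) (0, x) (0, y)).trans (le_of_eq ?_)
  rw [Prod.dist_eq, dist_self, max_eq_right dist_nonneg]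

theorem IsGloballyRegular.continuous_truncated {c : LQCoeff n m} {δ K M N : ℝ}
    (hc : c.IsGloballyRegular δ K) (hM : 0 < M) (hN : 0 < N) (r : ℝ) :
    Continuous fun q : ℝ × Matrix (Fin n) (Fin n) ℝ × Matrix (Fin n) (Fin n) ℝ =>
      c.riccatiField q.1 r (radialCut N q.2.1) (c.feedback r (psdCut M q.2.2)) := by
  have hQ : Continuous fun q : ℝ × Matrix (Fin n) (Fin n) ℝ × Matrix (Fin n) (Fin n) ℝ =>
      c.Q q.1 r := hc.Q_cont.comp (continuous_fst.prodMk continuous_const)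
  have hR : Continuous fun q : ℝ × Matrix (Fin n) (Fin n) ℝ × Matrix (Fin n) (Fin n) ℝ =>
      c.R q.1 r := hc.R_cont.comp (continuous_fst.prodMk continuous_const)
  have hx : Continuous fun q : ℝ × Matrix (Fin n) (Fin n) ℝ × Matrix (Fin n) (Fin n) ℝ =>
      radialCut N q.2.1 := (continuous_radialCut hN).comp (continuous_fst.comp continuous_snd)
  have hθ : Continuous fun q : ℝ × Matrix (Fin n) (Fin n) ℝ × Matrix (Fin n) (Fin n) ℝ =>
      c.feedback r (psdCut M q.2.2) :=
    (hc.continuous_feedback hM r).comp (continuous_snd.comp continuous_snd)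
  have hA := (continuous_const (y := c.A r)).add ((continuous_const (y := c.B r)).matrix_mul hθ)
  have hC := (continuous_const (y := c.C r)).add ((continuous_const (y := c.D r)).matrix_mul hθ)
  exact ((((hx.matrix_mul hA).add (hA.matrix_transpose.matrix_mul hx)).add
    ((hC.matrix_transpose.matrix_mul hx).matrix_mul hC)).add hQ).add
    ((hθ.matrix_transpose.matrix_mul hR).matrix_mul hθ)

theorem IsGloballyRegular.exists_truncated_solution {c : LQCoeff n m} {δ K T M : ℝ}
    (hc : c.IsGloballyRegular δ K) (hT : 0 ≤ T) (hM : 0 < M) :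
    ∃ P, c.IsLinearSolution T (fun s => c.feedback s (psdCut M (P s s))) P := by
  obtain ⟨hA, hC, hS⟩ := hc.uniformlyBddLip_closedLoop hM
  obtain ⟨KΘ, -, hΘb, hΘl⟩ := hc.uniformlyBddLip_feedback hM
  obtain ⟨K₁, h10, h1, -⟩ := hA
  obtain ⟨K₂, h20, h2, -⟩ := hC
  obtain ⟨K₃, h30, h3, -⟩ := hS
  have hK : 0 ≤ K := (norm_nonneg _).trans (hc.A_le 0)
  set a := max K₁ K₂ with ha
  have ha0 : 0 ≤ a := h10.trans (le_max_left _ _)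
  set L : ℝ := 2 * n * a + n * n * a * a + 1 with hL
  have hL0 : 0 < L := by positivity
  -- the a priori bound for the solution, at which the first argument is truncated
  set g : ℝ := K + K₃ * T with hg
  have hg0 : 0 ≤ g := by positivity
  set N : ℝ := 2 * g * Real.exp (4 * L * T) + 1 with hN
  have hN0 : 0 < N := by positivity
  obtain ⟨K₄, h40, h4b, h4l⟩ := hc.uniformlyBddLip_riccatiField hM hN0
  set Kf : ℝ := max (K₄ + 1) K with hKf
  have hKf0 : 0 < Kf := lt_max_of_lt_left (by positivity)
  have h4Kf : K₄ ≤ Kf := le_trans (by linarith) (le_max_left (K₄ + 1) K)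
  obtain ⟨P, hPc, hP⟩ := exists_volterra_solution (K := Kf) hT hKf0 hc.G_cont
    (fun t => (hc.G_le t).trans (le_max_right _ _))
    (f := fun t r x y => c.riccatiField t r (radialCut N x) (c.feedback r (psdCut M y)))
    (fun t u v hu hv => (hc.stronglyMeasurable_riccatiField
      (hc.stronglyMeasurable_feedback ((continuous_psdCut hM).comp hv).stronglyMeasurable)
      ((continuous_radialCut hN0).comp hu).stronglyMeasurable t).aestronglyMeasurable)
    (hc.continuous_truncated hM hN0)
    (fun t r x y => (h4b (t, r) (x, y)).trans h4Kf)
    (fun t r x y x' y' => by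
      refine (h4l (t, r) (x, y) (x', y')).trans ?_
      have : dist (x, y) (x', y') ≤ ‖x - x'‖ + ‖y - y'‖ := by
        rw [Prod.dist_eq, dist_eq_norm, dist_eq_norm]
        exact max_le_add_of_nonneg (norm_nonneg _) (norm_nonneg _)
      gcongr)
  have hPr : ∀ t, Continuous (P t) := fun t => hPc.comp (continuous_const.prodMk continuous_id)
  have hPd : Continuous fun s => P s s := hPc.comp (continuous_id.prodMk continuous_id)
  have hbound : ∀ t, ∀ s ∈ Icc 0 T, ‖P t s‖ ≤ N := by
    intro t s hs
    have := le_of_le_integral_triangle (d := fun _ s => ‖P t s‖) hT hL0 hg0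
      (Continuous.continuousOn (((hPr t).comp continuous_snd).norm)) (fun t' s' hs' => ?_)
      0 s ⟨le_rfl, hs.1, hs.2⟩
    · refine this.trans (le_trans ?_ (le_add_of_nonneg_right zero_le_one))
      gcongr
      linarith [hs.1]
    · have hsI : s' ∈ Icc 0 T := ⟨hs'.1.trans hs'.2.1, hs'.2.2⟩
      have hptw : ∀ r, ‖c.riccatiField t r (radialCut N (P t r))
          (c.feedback r (psdCut M (P r r)))‖ ≤ K₃ + L * (‖P t r‖ + ‖P t r‖) := by
        intro r
        have hl := (norm_lyapunov_le ((h1 (t, r) (P t r, P r r)).trans (le_max_left K₁ K₂))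
          ((h2 (t, r) (P t r, P r r)).trans (le_max_right K₁ K₂))).trans
            (mul_le_mul_of_nonneg_left (norm_radialCut_le_norm hN0 (P t r)) (by positivity))
        have hs := norm_add_le_of_le hl (h3 (t, r) (P t r, P r r))
        rw [← add_assoc] at hs
        refine le_trans hs ?_
        have : 0 ≤ ‖P t r‖ := norm_nonneg _
        nlinarith
      have hci : Continuous fun r => L * (‖P t r‖ + ‖P t r‖) := by
        have := (hPr t).norm
        fun_prop
      have hi : ‖∫ r in s'..T, c.riccatiField t r (radialCut N (P t r))
          (c.feedback r (psdCut M (P r r)))‖ ≤ ∫ r in s'..T, (K₃ + L * (‖P t r‖ + ‖P t r‖)) :=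
        intervalIntegral.norm_integral_le_of_norm_le hsI.2 (.of_forall fun r _ => hptw r)
          ((continuous_const.add hci).intervalIntegrable _ _)
      rw [intervalIntegral.integral_add intervalIntegrable_const (hci.intervalIntegrable _ _),
        intervalIntegral.integral_const, smul_eq_mul] at hi
      rw [hP t s' hsI]
      refine (norm_add_le_of_le (hc.G_le t) hi).trans ?_
      have : (T - s') * K₃ ≤ K₃ * T := by nlinarith [hsI.1]
      linarith
  refine ⟨P, hc.stronglyMeasurable_feedback ((continuous_psdCut hM).comp hPd).stronglyMeasurable,
    ⟨KΘ, fun s => hΘb (0, s) (0, P s s)⟩, hPc, fun t s hs => ?_⟩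
  rw [hP t s hs]
  congr 1
  refine intervalIntegral.integral_congr fun r hr => ?_
  rw [uIcc_of_le hs.2] at hr
  simp only [radialCut_of_norm_le hN0 (hbound t r ⟨hs.1.trans hr.1, hr.2⟩)]

/-! ### Existence and uniqueness -/

theorem AgreeOn.memLInfty_theta {c c' : LQCoeff n m} {T : ℝ} (h : AgreeOn c c' T)
    {P : ℝ → ℝ → Matrix (Fin n) (Fin n) ℝ} (hP : MemLInfty T (c.Theta P)) :
    MemLInfty T (c'.Theta P) := by
  intro i j
  refine (hP i j).ae_eq ?_
  filter_upwards [h.theta_ae_eq P] with s hs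
  rw [hs]

/-- Existence: the diagonal bound does not depend on the truncation level, so at a high enough
level the truncated solution solves the Riccati equation itself. -/
theorem IsGloballyRegular.exists_isERESolution {c : LQCoeff n m} {δ K T : ℝ}
    (hc : c.IsGloballyRegular δ K) (hT : 0 ≤ T) :
    ∃ P, c.IsERESolution T P ∧ MemLInfty T (c.Theta P) := by
  have hK : 0 ≤ K := (norm_nonneg _).trans (hc.A_le 0)
  set M := max 1 (gronwallBound (c.G T).trace (n * (2 * n * K + n * n * K * K)) (n * K) T) with hMd
  have hM : 0 < M := lt_max_of_lt_left one_pos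
  obtain ⟨P, hP⟩ := hc.exists_truncated_solution hT hM
  have hcut : ∀ s ∈ Icc 0 T, psdCut M (P s s) = P s s := by
    intro s hs
    have hpsd := hP.posSemidef hc s s hs
    refine psdCut_of_norm_le hM hpsd (hpsd.norm_le_trace.trans ?_)
    refine (hP.trace_diag_le hc hM s hs).trans (le_trans ?_ (le_max_right _ _))
    exact gronwallBound_mono (hc.G_psd T).trace_nonneg (by positivity) (by positivity)
      (by linarith [hs.1])
  have hfield : ∀ t, ∀ r ∈ Icc 0 T,
      c.ereField P t r = c.riccatiField t r (P t r) (c.feedback r (psdCut M (P r r))) := by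
    intro t r hr
    rw [ereField_eq, hcut r hr]
  refine ⟨P, ⟨hP.cont.continuousOn,
    fun t s hts => hP.posSemidef hc t s ⟨hts.1.trans hts.2.1, hts.2.2⟩,
    fun t ht i j => ?_, fun t s hts i j => ?_⟩, ?_⟩
  · refine (intervalIntegrable_matrix_apply
      (hP.intervalIntegrable_riccatiField hc t t T) i j).congr fun r hr => ?_
    rw [uIoc_of_le ht.2] at hr
    simp only [hfield t r ⟨ht.1.trans hr.1.le, hr.2⟩]
  · have h0s : 0 ≤ s := hts.1.trans hts.2.1
    have he := congrFun (congrFun (hP.eq t s ⟨h0s, hts.2.2⟩) i) j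
    rw [Matrix.add_apply,
      integral_matrix_apply (hP.intervalIntegrable_riccatiField hc t s T)] at he
    rw [he]
    congr 1
    refine intervalIntegral.integral_congr fun r hr => ?_
    rw [uIcc_of_le hts.2.2] at hr
    simp only [hfield t r ⟨h0s.trans hr.1, hr.2⟩]
  · obtain ⟨L, hL⟩ := hP.bdd
    have hdiag : Continuous fun s => P s s := hP.cont.comp (continuous_id.prodMk continuous_id)
    refine memLInfty_of_norm_le (hc.stronglyMeasurable_feedback hdiag.stronglyMeasurable)
      (K := L) fun s hs => ?_
    have := hL s
    rwa [hcut s hs] at this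

/-- Uniqueness: two solutions are bounded on the triangle, so both solve one truncated equation,
whose right-hand side is Lipschitz. -/
theorem IsGloballyRegular.isERESolution_unique {c : LQCoeff n m} {δ K T : ℝ}
    (hc : c.IsGloballyRegular δ K) (hT : 0 ≤ T) {P P' : ℝ → ℝ → Matrix (Fin n) (Fin n) ℝ}
    (hP : c.IsERESolution T P) (hP' : c.IsERESolution T P') :
    ∀ t s, (t, s) ∈ triangle T → P' t s = P t s := by
  obtain ⟨N, hN⟩ := (isCompact_triangle T).exists_bound_of_continuousOn hP.cont
  obtain ⟨N', hN'⟩ := (isCompact_triangle T).exists_bound_of_continuousOn hP'.cont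
  set M := max 1 (max N N') with hMd
  have hM : 0 < M := lt_max_of_lt_left one_pos
  obtain ⟨K₀, hK₀, -, hl⟩ := hc.uniformlyBddLip_riccatiField hM hM
  have hfield : ∀ {R : ℝ → ℝ → Matrix (Fin n) (Fin n) ℝ},
      (∀ t s, (t, s) ∈ triangle T → (R t s).PosSemidef ∧ ‖R t s‖ ≤ M) →
      ∀ t r, (t, r) ∈ triangle T → c.ereField R t r =
        c.riccatiField t r (radialCut M (R t r)) (c.feedback r (psdCut M (R r r))) := by
    intro R hR t r htr
    obtain ⟨h1, h2⟩ := hR r r ⟨htr.1.trans htr.2.1, le_rfl, htr.2.2⟩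
    rw [ereField_eq, psdCut_of_norm_le hM h1 h2, radialCut_of_norm_le hM (hR t r htr).2]
  have hf := hfield (R := P) fun t s h =>
    ⟨hP.posSemidef t s h, (hN (t, s) h).trans ((le_max_left N N').trans (le_max_right _ _))⟩
  have hf' := hfield (R := P') fun t s h =>
    ⟨hP'.posSemidef t s h, (hN' (t, s) h).trans ((le_max_right N N').trans (le_max_right _ _))⟩
  have hlip : ∀ t r, (t, r) ∈ triangle T → ∀ i j,
      ‖c.ereField P' t r i j - c.ereField P t r i j‖ ≤
        (K₀ + 1) * (‖P' t r - P t r‖ + ‖P' r r - P r r‖) := by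
    intro t r htr i j
    rw [hf t r htr, hf' t r htr, ← Matrix.sub_apply]
    refine (Matrix.norm_entry_le_entrywise_sup_norm _).trans
      ((hl (t, r) (P' t r, P' r r) (P t r, P r r)).trans ?_)
    rw [Prod.dist_eq, dist_eq_norm, dist_eq_norm]
    have := max_le_add_of_nonneg (norm_nonneg (P' t r - P t r)) (norm_nonneg (P' r r - P r r))
    gcongr
    linarith
  have hdc : ContinuousOn (fun p : ℝ × ℝ => ‖P' p.1 p.2 - P p.1 p.2‖) (triangle T) :=
    (hP'.cont.sub hP.cont).norm
  intro t s hts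
  have key := le_of_le_integral_triangle (d := fun t s => ‖P' t s - P t s‖) (K := K₀ + 1) hT
    (by positivity) le_rfl hdc (fun t s hts => ?_) t s hts
  · rw [mul_zero, zero_mul] at key
    exact sub_eq_zero.1 (norm_le_zero_iff.1 key)
  · have hsT : s ≤ T := hts.2.2
    have hci : ContinuousOn (fun r => (K₀ + 1) * (‖P' t r - P t r‖ + ‖P' r r - P r r‖))
        (Icc s T) :=
      continuousOn_const.mul ((hdc.triangle_slice (u := fun t s => ‖P' t s - P t s‖) hts).add
        ((hdc.triangle_diag (u := fun t s => ‖P' t s - P t s‖)).mono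
          (Icc_subset_Icc_left (hts.1.trans hts.2.1))))
    have hsub : uIcc s T ⊆ uIcc t T := by
      rw [uIcc_of_le hsT, uIcc_of_le (hts.2.1.trans hsT)]
      exact Icc_subset_Icc_left hts.2.1
    have htI : t ∈ Icc 0 T := ⟨hts.1, hts.2.1.trans hsT⟩
    have hnn : 0 ≤ ∫ r in s..T, (K₀ + 1) * (‖P' t r - P t r‖ + ‖P' r r - P r r‖) :=
      intervalIntegral.integral_nonneg hsT fun r _ => by positivity
    rw [zero_add]
    refine (Matrix.norm_le_iff hnn).2 fun i j => ?_
    rw [Matrix.sub_apply, hP'.eq t s hts i j, hP.eq t s hts i j, add_sub_add_left_eq_sub,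
      ← intervalIntegral.integral_sub ((hP'.integrable t htI i j).mono_set hsub)
        ((hP.integrable t htI i j).mono_set hsub)]
    refine intervalIntegral.norm_integral_le_of_norm_le hsT (.of_forall fun r hr => ?_)
      (hci.intervalIntegrable_of_Icc hsT)
    exact hlip t r ⟨hts.1, hts.2.1.trans hr.1.le, hr.2⟩ i j

end LQCoeff

end EquilibriumRiccati

theorem proposition5p1 (n m : ℕ) (T : ℝ) (hT : 0 < T) (c : LQCoeff n m)
    (hreg : c.IsRegular T) (hpos : c.IsPositive T) (hmono : c.IsMonotone T) :
    ∃ P : ℝ → ℝ → Matrix (Fin n) (Fin n) ℝ,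
      c.IsERESolution T P ∧
      (∀ P' : ℝ → ℝ → Matrix (Fin n) (Fin n) ℝ, c.IsERESolution T P' →
        ∀ t s : ℝ, (t, s) ∈ triangle T → P' t s = P t s) ∧
      MemLInfty T (c.Theta P) := by
  obtain ⟨c', δ, K, hc', hcc'⟩ := LQCoeff.exists_isGloballyRegular hT.le hreg hpos hmono
  obtain ⟨P, hP, hΘ⟩ := hc'.exists_isERESolution hT.le
  exact ⟨P, hcc'.symm.isERESolution hP,
    fun P' hP' => hc'.isERESolution_unique hT.le hP (hcc'.isERESolution hP'),
    hcc'.symm.memLInfty_theta hΘ⟩
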